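/- **Setting.** Let $A$ (actions, nonempty) and $S$ (outcomes) be finite sets and $\eta>0$. A contractual bandit problem consists of outcome distributions $P(a)\in\Delta(S)$, a reward function $\iota:S\to\mathbb R$ with means $r(a)=P(a)\cdot\iota\in[0,1]$, and agent's costs $c(a)\in[0,1]$ ($a\in A$). Contracts are vectors $x\in\mathcal X=[0,\eta]^S$. In round $t$ the principal posts $x_t\in\mathcal X$; the agent takes an action $a_t\in\arg\max_{a}\{P(a)\cdot x_t-c(a)\}$, given by a best-response function $\beta$ of the contract, $a_t=\beta(x_t)$, whose tie-breaking is arbitrary; an outcome $s_t\sim P(a_t)$ is drawn independently of the past given $a_t$; the principal receives $\iota(s_t)$, pays $x_t(s_t)$, and observes $a_t$, $s_t$ and $\iota(s_t)$. Let $$\mathcal X^a=\{x\in\mathcal X:[P(a)-P(a')]\cdot x\ge c(a)-c(a')\ \ \forall a'\ne a\},\qquad \zeta(a)=\min_{x\in\mathcal X^a}P(a)\cdot x,$$ $$\mathrm{Reg}(T)=\max_{a^*\in A}\sum_{t=1}^T[r(a^*)-\zeta(a^*)]-\sum_{t=1}^T[r(a_t)-P(a_t)\cdot x_t].$$ The problem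 is *$\lambda$-inducible* ($\lambda>0$) if for every $a\in A$ there is $e\in\{0,1\}^S$ with $[P(a)-P(a')]\cdot e\ge\lambda$ for all $a'\neq a$. **Statement.** There is a universal exponent $k\in\mathbb N$ such that the following holds. Let $A,S,\eta,\lambda>0$, a reward bound $B$ and a cost function $c$ (all known to the principal) be given, with $c(a)-c(a')<\lambda\eta$ for all $a,a'\in A$. Then there are a constant $C$ and a learning algorithm (a rule choosing $x_{t}\in\mathcal X$ from the observations of rounds $1,\dots,t-1$, not knowing the horizon), both depending only on $A,S,\eta,\lambda,B,c$, such that for every $\lambda$-inducible contractual bandit problem with cost function $c$ and $|\iota|\le B$ (with $P$ and $\iota$ unknown to the principal), every best-response function $\beta$ and every $T\ge2$, $$\mathbb E[\mathrm{Reg}(T)]\le C\,\sqrt T\,(\log T)^k .$$ That is, with known costs, $\tilde O(\sqrt T)$ expected regret is achieved under $\lambda$-inducibility. -/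

import Mathlib

open scoped Matrix

/-- A contractual bandit problem with finite action set `A` and finite outcome set `S`:
outcome distributions `P a`, noisy reward `reward s` of an outcome, agent's cost `cost a`.
The expected reward and the cost of every action lie in `[0,1]`. -/
structure ContractualBandit (A : Type*) (S : Type*) [Fintype S] where
  P : A → S → ℝ
  reward : S → ℝ
  cost : A → ℝ
  P_mem : ∀ a, P a ∈ stdSimplex ℝ S
  meanReward_mem : ∀ a, P a ⬝ᵥ reward ∈ Set.Icc (0 : ℝ) 1
  cost_mem : ∀ a, cost a ∈ Set.Icc (0 : ℝ) 1

/-- The contracts `x : S → [0, η]`. -/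
def contractSpace (S : Type*) (η : ℝ) : Set (S → ℝ) :=
  {x | ∀ s, x s ∈ Set.Icc 0 η}

/-- What is on record after one round: the posted contract, the agent's action, the outcome and
the principal's reward. -/
structure Round (A : Type*) (S : Type*) where
  contract : S → ℝ
  action : A
  outcome : S
  reward : ℝ

/-- A (deterministic) learning algorithm chooses the next contract from the list of past rounds,
oldest round first. -/
abbrev LearningAlgorithm (A : Type*) (S : Type*) := List (Round A S) → S → ℝ

namespace ContractualBandit

variable {A : Type*} {S : Type*} [Fintype S] (M : ContractualBandit A S)

/-- Expected reward `r a` of the principal when the agent takes action `a`. -/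
def meanReward (a : A) : ℝ := M.P a ⬝ᵥ M.reward

/-- `lam`-inducibility: every action `a` has an event `e ∈ {0,1}^S` whose probability under `a`
exceeds its probability under any other action by at least `lam`. -/
def Inducible (lam : ℝ) : Prop :=
  ∀ a, ∃ e : S → ℝ, (∀ s, e s = 0 ∨ e s = 1) ∧ ∀ a', a' ≠ a → lam ≤ (M.P a - M.P a') ⬝ᵥ e

/-- The contracts under which action `a` is a best response of the agent. -/
def inducingContracts (η : ℝ) (a : A) : Set (S → ℝ) :=
  {x | x ∈ contractSpace S η ∧
    ∀ a', a' ≠ a → M.cost a - M.cost a' ≤ (M.P a - M.P a') ⬝ᵥ x}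

/-- The least expected payment `ζ a` that induces action `a`. -/
noncomputable def leastPayment (η : ℝ) (a : A) : ℝ :=
  sInf ((fun x => M.P a ⬝ᵥ x) '' M.inducingContracts η a)

/-- `β` selects, for every contract, an action that maximizes the agent's expected utility;
ties are broken in an arbitrary way. -/
def IsBestResponse (η : ℝ) (β : (S → ℝ) → A) : Prop :=
  ∀ x ∈ contractSpace S η, ∀ a, M.P a ⬝ᵥ x - M.cost a ≤ M.P (β x) ⬝ᵥ x - M.cost (β x)

/-- Regret of the rounds in `h`, against the best action induced at the least payment. -/
noncomputable def regret (η : ℝ) (h : List (Round A S)) : ℝ :=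
  (⨆ a, (h.map fun _ => M.meanReward a - M.leastPayment η a).sum) -
    (h.map fun ρ => M.meanReward ρ.action - M.P ρ.action ⬝ᵥ ρ.contract).sum

/-- Expectation of `f (history)` after `n` further rounds of play from history `h`: in each round
the algorithm posts `alg h`, the agent answers with `β (alg h)`, and the outcome is drawn from the
distribution of that action, independently of the past. -/
noncomputable def expectAfter (β : (S → ℝ) → A) (alg : LearningAlgorithm A S)
    (f : List (Round A S) → ℝ) : ℕ → List (Round A S) → ℝ
  | 0, h => f h
  | n + 1, h => ∑ s, M.P (β (alg h)) s *
      expectAfter β alg f n (h ++ [⟨alg h, β (alg h), s, M.reward s⟩])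

/-- Expected regret of `T` rounds. -/
noncomputable def expectedRegret (η : ℝ) (β : (S → ℝ) → A) (alg : LearningAlgorithm A S)
    (T : ℕ) : ℝ :=
  M.expectAfter β alg (M.regret η) T []

end ContractualBandit

/-! The learner is optimistic about means and uses the agent's answers to refute wrong models. The
version space collects the inducible models that explain all answers so far; since costs are known,
the true `P` always belongs to it. Each round outside the initial probes and the searches picks a
surviving model and a goal contract inducing a target in that model, maximizing an upper confidence
bound for utility. As `P` survives, the true optimum is among the candidates, so an answer by the
target costs only the confidence bonus and the tuning slack. The bonuses add up to order `√T` times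
a logarithm.

The danger is an answer by another action. Posting all `0`/`η` contracts first yields, for every
action, a base contract that induces it with margin `kappa` in every surviving model
(`robustContracts_nonempty`). The posted contract lies slightly short of the goal on the segment
from the base, so a deviation there refutes the model by a definite amount. Bisection on the segment
then locates a point where target and competitor are almost indifferent, in the truth and in every
surviving model, while the refuted model still has a clear margin (`SearchValid.exists_record`).

Every search thus gives a model error and a linear functional on `A × S`. An error is large on its
own functional and tiny on those found earlier, so the matrix of products is nearly triangular. It
has rank at most `|A| |S|`, which bounds the number of searches on each dyadic time scale
(`RecordsValid.length_le`). Searches therefore take only polylogarithmically many rounds.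

Concentration is handled without probabilities of events: regret is bounded along every history by a
deterministic term plus exponential penalties whose conditional expectations do not increase
(`Fits.sum_regret_le`, `IsSupersolution.expectAfter_le`). -/

/-! ### Nearly triangular matrices and the dimension bound -/

/-- A square matrix with small entries above a large diagonal is nonsingular. -/
theorem Matrix.det_ne_zero_of_small_upper {m : ℕ} (M : Matrix (Fin m) (Fin m) ℝ) {ε R G : ℝ}
    (hε : 0 ≤ ε) (hG : 0 < G) (hR : ∀ i j, |M i j| ≤ R) (hup : ∀ i j, i < j → |M i j| ≤ ε)
    (hd : ∀ i, G ≤ M i i) (hs : (m.factorial : ℝ) * (ε * R ^ (m - 1)) < G ^ m) : M.det ≠ 0 := by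
  classical
  have hterm : ∀ σ : Equiv.Perm (Fin m), σ ≠ 1 →
      |Equiv.Perm.sign σ • ∏ i, M (σ i) i| ≤ ε * R ^ (m - 1) := by
    intro σ hσ
    -- If `j ≤ σ j` for all `j`, then `∑ σ j = ∑ j` forces equality. So each non-identity term of
    -- the determinant contains an entry `M (σ i) i` above the diagonal.
    obtain ⟨i, hi⟩ : ∃ i, σ i < i := by
      by_contra! hcon
      apply hσ
      ext i
      by_contra hne
      have hlt : ∑ j : Fin m, (j : ℕ) < ∑ j, ((σ j : Fin m) : ℕ) :=
        Finset.sum_lt_sum (fun j _ => hcon j) ⟨i, Finset.mem_univ _, by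
          have := hcon i
          simp only [Equiv.Perm.coe_one, id_eq] at hne
          have h2 : (i : ℕ) ≤ σ i := this
          omega⟩
      rw [Equiv.sum_comp σ (fun j : Fin m => (j : ℕ))] at hlt
      exact lt_irrefl _ hlt
    have habs : |Equiv.Perm.sign σ • ∏ i, M (σ i) i| = ∏ i, |M (σ i) i| := by
      rw [← Finset.abs_prod]
      rcases Int.units_eq_one_or (Equiv.Perm.sign σ) with h | h <;> simp [h]
    rw [habs, ← Finset.mul_prod_erase _ _ (Finset.mem_univ i)]
    have hcard : (Finset.univ.erase i).card = m - 1 := by simp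
    refine mul_le_mul (hup _ _ hi) ?_ (Finset.prod_nonneg fun _ _ => abs_nonneg _) hε
    calc ∏ j ∈ Finset.univ.erase i, |M (σ j) j| ≤ ∏ _j ∈ Finset.univ.erase i, R :=
          Finset.prod_le_prod (fun _ _ => abs_nonneg _) fun _ _ => hR _ _
      _ = R ^ (m - 1) := by simp
  intro h0
  rw [Matrix.det_apply, ← Finset.add_sum_erase _ _ (Finset.mem_univ 1)] at h0
  have h1 : G ^ m ≤ Equiv.Perm.sign (1 : Equiv.Perm (Fin m)) •
      ∏ i, M ((1 : Equiv.Perm (Fin m)) i) i := by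
    simp only [Equiv.Perm.sign_one, Equiv.Perm.coe_one, id_eq, one_smul]
    calc G ^ m = ∏ _i : Fin m, G := by simp
      _ ≤ _ := Finset.prod_le_prod (fun _ _ => hG.le) fun i _ => hd i
  -- The empty matrix is separate because `0 ≤ R` is read off from an entry.
  rcases Nat.eq_zero_or_pos m with rfl | hm
  · have : IsEmpty (Fin 0) := inferInstance
    have he : (Finset.univ.erase (1 : Equiv.Perm (Fin 0))) = ∅ := by
      ext σ
      simp [Subsingleton.elim σ 1]
    rw [he] at h0
    simp at h0
  have hR0 : 0 ≤ R := (abs_nonneg _).trans (hR ⟨0, hm⟩ ⟨0, hm⟩)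
  have h2 : |∑ σ ∈ Finset.univ.erase (1 : Equiv.Perm (Fin m)),
      Equiv.Perm.sign σ • ∏ i, M (σ i) i| ≤ (m.factorial : ℝ) * (ε * R ^ (m - 1)) := by
    refine (Finset.abs_sum_le_sum_abs _ _).trans ?_
    calc _ ≤ ∑ _σ ∈ Finset.univ.erase (1 : Equiv.Perm (Fin m)), ε * R ^ (m - 1) :=
          Finset.sum_le_sum fun σ hσ => hterm σ (Finset.ne_of_mem_erase hσ)
      _ ≤ ∑ _σ : Equiv.Perm (Fin m), ε * R ^ (m - 1) :=
          Finset.sum_le_sum_of_subset_of_nonneg (Finset.erase_subset _ _)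
            fun _ _ _ => by positivity
      _ = (m.factorial : ℝ) * (ε * R ^ (m - 1)) := by
          simp [Fintype.card_perm]
  have := neg_le_of_abs_le h2
  linarith

/-- A sequence of pairs `(w i, φ i)` of vectors with large `w i ⬝ᵥ φ i` and small `w i ⬝ᵥ φ j` for
`i < j` is not longer than the dimension. -/
theorem length_le_card_of_small_dotProduct {ι : Type*} [Fintype ι] {m : ℕ} (w φ : Fin m → ι → ℝ)
    {ε R G : ℝ} (hε : 0 ≤ ε) (hG : 0 < G) (hR : ∀ i j, |w i ⬝ᵥ φ j| ≤ R)
    (hup : ∀ i j, i < j → |w i ⬝ᵥ φ j| ≤ ε) (hd : ∀ i, G ≤ w i ⬝ᵥ φ i)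
    (hs : ((Fintype.card ι + 1).factorial : ℝ) * (ε * R ^ Fintype.card ι) < G ^ (Fintype.card ι + 1)) :
    m ≤ Fintype.card ι := by
  by_contra! hlt
  let f : Fin (Fintype.card ι + 1) → Fin m := Fin.castLE hlt
  let W : Matrix (Fin (Fintype.card ι + 1)) ι ℝ := Matrix.of fun i => w (f i)
  let Φ : Matrix ι (Fin (Fintype.card ι + 1)) ℝ := Matrix.of fun s i => φ (f i) s
  have hent : ∀ i j, (W * Φ) i j = w (f i) ⬝ᵥ φ (f j) := fun i j => rfl
  have hdet : (W * Φ).det ≠ 0 := by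
    refine Matrix.det_ne_zero_of_small_upper _ hε hG (R := R) ?_ ?_ ?_ (by simpa using hs)
    · intro i j; rw [hent]; exact hR _ _
    · intro i j hij; rw [hent]; exact hup _ _ hij
    · intro i; rw [hent]; exact hd _
  -- Nonsingular of order `card ι + 1`, yet a product through a space of dimension `card ι`.
  have hrank : (W * Φ).rank = Fintype.card ι + 1 := by
    rw [Matrix.rank_of_isUnit _ ((Matrix.isUnit_iff_isUnit_det _).2 hdet.isUnit)]
    simp
  have h2 := (Matrix.rank_mul_le_left W Φ).trans (Matrix.rank_le_card_width W)
  omega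

/-! ### The learning algorithm -/

/-- What the learner knows in advance, with its tuning parameters: `kappa` is the margin required
of a base contract, `bonus` scales the confidence bonus, and `depth k` is the number of bisection
steps of a search started in the rounds `2 ^ k - 1, …, 2 ^ (k + 1) - 2`. -/
structure LearnerParams (A : Type*) where
  eta : ℝ
  lam : ℝ
  kappa : ℝ
  bonus : ℝ
  cost : A → ℝ
  depth : ℕ → ℕ

/-- An action to be induced, a contract `base` inducing it with a margin, a model of the outcome
distributions and a contract `goal` inducing the action in the model. -/
structure ContractPlan (A S : Type*) where
  target : A
  base : S → ℝ
  model : A → S → ℝ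
  goal : S → ℝ

instance {A S : Type*} [Nonempty A] : Nonempty (ContractPlan A S) :=
  ⟨⟨Classical.arbitrary A, 0, 0, 0⟩⟩

/-- The point at parameter `τ` of the segment from the base to the goal. -/
def ContractPlan.point {A S : Type*} (π : ContractPlan A S) (τ : ℝ) : S → ℝ :=
  π.base + τ • (π.goal - π.base)

theorem ContractPlan.point_eq {A S : Type*} (π : ContractPlan A S) (τ : ℝ) :
    π.point τ = (1 - τ) • π.base + τ • π.goal := by
  simp only [ContractPlan.point]; module

theorem convex_contractSpace {S : Type*} (η : ℝ) : Convex ℝ (contractSpace S η) := by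
  have : contractSpace S η = Set.pi Set.univ fun _ => Set.Icc 0 η :=
    Set.ext fun _ => Set.mem_univ_pi.symm
  rw [this]
  exact convex_pi fun _ _ => convex_Icc _ _

theorem ContractPlan.point_mem {A S : Type*} {π : ContractPlan A S} {η τ : ℝ}
    (hb : π.base ∈ contractSpace S η) (hg : π.goal ∈ contractSpace S η) (h0 : 0 ≤ τ)
    (h1 : τ ≤ 1) : π.point τ ∈ contractSpace S η := by
  rw [π.point_eq]
  exact convex_contractSpace η hb hg (by linarith) h0 (by ring)

/-- A bisection on the segment of a plan, with `left` steps to go. -/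
structure SegmentSearch (A S : Type*) where
  plan : ContractPlan A S
  lo : ℝ
  hi : ℝ
  level : ℕ
  left : ℕ

namespace SegmentSearch

variable {A S : Type*}

noncomputable def mid (σ : SegmentSearch A S) : ℝ := (σ.lo + σ.hi) / 2

open Classical in
/-- The search after the agent's answer `a` to the midpoint. -/
noncomputable def next (σ : SegmentSearch A S) (a : A) : Option (SegmentSearch A S) :=
  if σ.left = 0 then none
  else if a = σ.plan.target then some { σ with lo := σ.mid, left := σ.left - 1 }
  else some { σ with hi := σ.mid, left := σ.left - 1 }

end SegmentSearch

/-- Histories that arise when the learner `alg` plays against the best response `β`. -/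
inductive ContractualBandit.Plays {A S : Type*} [Fintype S] (M : ContractualBandit A S)
    (β : (S → ℝ) → A) (alg : LearningAlgorithm A S) : List (Round A S) → Prop
  | nil : M.Plays β alg []
  | snoc {h : List (Round A S)} (s : S) : M.Plays β alg h →
      M.Plays β alg (h ++ [⟨alg h, β (alg h), s, M.reward s⟩])

open Classical in
/-- The number of rounds of `h` with action `a`. -/
noncomputable def actionCount {A S : Type*} (a : A) (h : List (Round A S)) : ℕ :=
  (h.map fun ρ => if ρ.action = a then 1 else 0).sum

namespace LearnerParams

variable {A S : Type*} [Fintype S] (p : LearnerParams A)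

/-- The `lam`-inducible models under which the agent's actions in `h` are best responses. -/
def versionSpace (h : List (Round A S)) : Set (A → S → ℝ) :=
  {Q | (∀ a, Q a ∈ stdSimplex ℝ S) ∧
    (∀ a, ∃ e : S → ℝ, (∀ s, e s = 0 ∨ e s = 1) ∧
      ∀ a', a' ≠ a → p.lam ≤ (Q a - Q a') ⬝ᵥ e) ∧
    ∀ ρ ∈ h, ∀ a', p.cost ρ.action - p.cost a' ≤ (Q ρ.action - Q a') ⬝ᵥ ρ.contract}

/-- The contracts that induce `a` with margin `kappa` in all models of the version space. -/
def robustContracts (h : List (Round A S)) (a : A) : Set (S → ℝ) :=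
  {x | x ∈ contractSpace S p.eta ∧ ∀ Q ∈ p.versionSpace h, ∀ a', a' ≠ a →
    p.cost a - p.cost a' + p.kappa ≤ (Q a - Q a') ⬝ᵥ x}

/-- The base has to work in all surviving models because it is the left end of a bisection without
ever being posted for that purpose. The goal has to work in one model only: this is the optimism. -/
def admissiblePlans (h : List (Round A S)) : Set (ContractPlan A S) :=
  {π | π.base ∈ p.robustContracts h π.target ∧ π.model ∈ p.versionSpace h ∧
    π.goal ∈ contractSpace S p.eta ∧ ∀ a', p.cost π.target - p.cost a' ≤
      (π.model π.target - π.model a') ⬝ᵥ π.goal}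

/-- The distance kept from the goal, and the accuracy of the choice of a plan, in round `t`. -/
noncomputable def gap (t : ℕ) : ℝ := 1 / √(t + 1)

/-- The confidence radius of round `t`, before division by the square root of the count. -/
noncomputable def radius (t : ℕ) : ℝ := 4 * √(Real.log (t + 2))

open Classical in
/-- Upper confidence bound for the principal's utility under a plan. -/
noncomputable def index (h : List (Round A S)) (π : ContractPlan A S) : ℝ :=
  (h.map fun ρ => if ρ.action = π.target then ρ.reward - π.goal ρ.outcome else 0).sum /
      (actionCount π.target h + 1) +
    p.bonus * (radius h.length + 1) / √(actionCount π.target h + 1)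

/-- The supremum of the index need not be attained; the slack `gap` sums to order `√T`. -/
def IsNearOptimal (h : List (Round A S)) (π : ContractPlan A S) : Prop :=
  π ∈ p.admissiblePlans h ∧
    ∀ π' ∈ p.admissiblePlans h, p.index h π' ≤ p.index h π + gap h.length

/-- The initial contracts: `eta` on an event and `0` elsewhere. -/
noncomputable def probes (S : Type*) [Fintype S] (η : ℝ) : List (S → ℝ) :=
  letI : DecidableEq S := Classical.decEq S
  (Finset.univ : Finset (S → Bool)).toList.map fun e s => if e s then η else 0

variable [Nonempty A]

noncomputable def plan (h : List (Round A S)) : ContractPlan A S :=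
  Classical.epsilon (p.IsNearOptimal h)

open Classical in
/-- The search in progress after a history, given in reverse. -/
noncomputable def phase : List (Round A S) → Option (SegmentSearch A S)
  | [] => none
  | ρ :: g =>
    match phase g with
    | some σ => σ.next ρ.action
    | none =>
      if g.length < (probes S p.eta).length ∨ ρ.action = (p.plan g.reverse).target then none
      else some ⟨p.plan g.reverse, 0, 1 - gap g.length, Nat.log 2 (g.length + 1),
        p.depth (Nat.log 2 (g.length + 1))⟩

noncomputable def proposal (h : List (Round A S)) : S → ℝ :=
  match p.phase h.reverse with
  | some σ => σ.plan.point σ.mid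
  | none =>
    if ht : h.length < (probes S p.eta).length then (probes S p.eta)[h.length]
    else (p.plan h).point (1 - gap h.length)

-- The fallback `0` keeps the learner inside the contract space on histories that cannot arise in
-- play as well.
open Classical in
noncomputable def learner : LearningAlgorithm A S := fun h =>
  if p.proposal h ∈ contractSpace S p.eta then p.proposal h else 0

open Classical in
/-- The number of rounds, in a reversed history, that belong to a search or answer a plan's
contract by an action other than the target. -/
noncomputable def lostRounds : List (Round A S) → ℕ
  | [] => 0
  | ρ :: g => lostRounds g +
      if (p.phase g).isSome ∨
        ((probes S p.eta).length ≤ g.length ∧ ρ.action ≠ (p.plan g.reverse).target)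
      then 1 else 0

end LearnerParams

/-! ### Contracts, robust bases and near-optimal plans -/

section Geometry

variable {A S : Type*} [Fintype S]

theorem ContractPlan.dotProduct_point (π : ContractPlan A S) (τ : ℝ) (d : S → ℝ) :
    d ⬝ᵥ π.point τ = (1 - τ) * (d ⬝ᵥ π.base) + τ * (d ⬝ᵥ π.goal) := by
  rw [π.point_eq, dotProduct_add, dotProduct_smul, dotProduct_smul, smul_eq_mul, smul_eq_mul]

theorem dotProduct_mem_Icc_of_mem_contractSpace {q x : S → ℝ} (hq : q ∈ stdSimplex ℝ S) {η : ℝ}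
    (hx : x ∈ contractSpace S η) : q ⬝ᵥ x ∈ Set.Icc 0 η := by
  constructor
  · exact Finset.sum_nonneg fun s _ => mul_nonneg (hq.1 s) (hx s).1
  · calc q ⬝ᵥ x ≤ ∑ s, q s * η := Finset.sum_le_sum fun s _ =>
          mul_le_mul_of_nonneg_left (hx s).2 (hq.1 s)
      _ = η := by rw [← Finset.sum_mul, hq.2, one_mul]

end Geometry

namespace LearnerParams

variable {A S : Type*} [Fintype S] (p : LearnerParams A)

theorem mem_probes {η : ℝ} {x : S → ℝ} :
    x ∈ probes S η ↔ ∃ e : S → Bool, x = fun s => if e s then η else 0 := by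
  classical
  simp only [probes, List.mem_map, Finset.mem_toList, Finset.mem_univ, true_and, @eq_comm _ x]

theorem probes_mem_contractSpace {η : ℝ} (hη : 0 ≤ η) {x : S → ℝ} (hx : x ∈ probes S η) :
    x ∈ contractSpace S η := by
  obtain ⟨e, rfl⟩ := mem_probes.1 hx
  intro s
  by_cases he : e s <;> simp [he, hη]

theorem versionSpace_append (h : List (Round A S)) (ρ : Round A S) :
    p.versionSpace (h ++ [ρ]) ⊆ p.versionSpace h := fun _ hQ =>
  ⟨hQ.1, hQ.2.1, fun ρ' hρ' => hQ.2.2 ρ' (List.mem_append_left _ hρ')⟩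

/-- When all probes have been posted, every action has a robust contract. -/
theorem robustContracts_nonempty {h : List (Round A S)} {δ : ℝ} (hη : 0 < p.eta) (hδ : 0 < δ)
    (hmargin : ∀ a a', p.cost a - p.cost a' + δ ≤ p.lam * p.eta)
    (hκ : p.kappa * (2 : ℝ) ^ Fintype.card S ≤ δ)
    (hV : (p.versionSpace h).Nonempty)
    (hprobe : ∀ x ∈ probes S p.eta, ∃ ρ ∈ h, ρ.contract = x) (a : A) :
    (p.robustContracts h a).Nonempty := by
  classical
  let x : (S → Bool) → S → ℝ := fun e s => if e s then p.eta else 0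
  let E : Finset (S → Bool) := Finset.univ.filter fun e => ∃ ρ ∈ h, ρ.contract = x e ∧ ρ.action = a
  have hind : ∀ Q ∈ p.versionSpace h, ∃ e ∈ E, ∀ a', a' ≠ a →
      p.cost a - p.cost a' + δ ≤ (Q a - Q a') ⬝ᵥ x e := by
    intro Q hQ
    obtain ⟨e, he, hlam⟩ := hQ.2.1 a
    let e' : S → Bool := fun s => e s = 1
    have hxe : x e' = p.eta • e := by
      funext s
      rcases he s with h0 | h0 <;> simp [x, e', h0]
    have hm : ∀ a', a' ≠ a → p.cost a - p.cost a' + δ ≤ (Q a - Q a') ⬝ᵥ x e' := by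
      intro a' ha'
      rw [hxe, dotProduct_smul, smul_eq_mul]
      have := mul_le_mul_of_nonneg_left (hlam a' ha') hη.le
      linarith [hmargin a a']
    refine ⟨e', ?_, hm⟩
    obtain ⟨ρ, hρ, hρx⟩ := hprobe (x e') (mem_probes.2 ⟨e', rfl⟩)
    simp only [E, Finset.mem_filter, Finset.mem_univ, true_and]
    refine ⟨ρ, hρ, hρx, ?_⟩
    -- Had another action answered this probe, its optimality in `Q` would contradict the positive
    -- margin of `a`.
    by_contra hne
    have h1 := hQ.2.2 ρ hρ a
    have h2 := hm _ hne
    rw [hρx] at h1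
    rw [sub_dotProduct] at h1 h2
    linarith
  obtain ⟨Q₀, hQ₀⟩ := hV
  obtain ⟨e₀, he₀, -⟩ := hind Q₀ hQ₀
  have hcard : (0 : ℝ) < E.card := by exact_mod_cast Finset.card_pos.2 ⟨e₀, he₀⟩
  have hcard2 : (E.card : ℝ) ≤ 2 ^ Fintype.card S := by
    have : E.card ≤ 2 ^ Fintype.card S := by
      simpa using Finset.card_le_univ E
    exact_mod_cast this
  -- The average of the probes answered by `a`, which does not depend on `Q`. In every model all of
  -- them induce `a` weakly and at least one has margin `δ`, so the average keeps margin `δ /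
  -- E.card`, and `E.card ≤ 2 ^ card S`.
  refine ⟨∑ e ∈ E, (E.card : ℝ)⁻¹ • x e, ?_, ?_⟩
  · refine (convex_contractSpace p.eta).sum_mem (fun _ _ => by positivity) ?_ fun e _ =>
      probes_mem_contractSpace hη.le (mem_probes.2 ⟨e, rfl⟩)
    rw [Finset.sum_const, nsmul_eq_mul, mul_inv_cancel₀ hcard.ne']
  · intro Q hQ a' ha'
    obtain ⟨e, he, hm⟩ := hind Q hQ
    have hall : ∀ e ∈ E, 0 ≤ (Q a - Q a') ⬝ᵥ x e - (p.cost a - p.cost a') := by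
      intro e he
      simp only [E, Finset.mem_filter, Finset.mem_univ, true_and] at he
      obtain ⟨ρ, hρ, hρx, rfl⟩ := he
      have := hQ.2.2 ρ hρ a'
      rw [hρx] at this
      linarith
    have hsum : δ ≤ ∑ e ∈ E, ((Q a - Q a') ⬝ᵥ x e - (p.cost a - p.cost a')) :=
      le_trans (by linarith [hm a' ha']) (Finset.single_le_sum hall he)
    rw [Finset.sum_sub_distrib, Finset.sum_const, nsmul_eq_mul] at hsum
    rw [← Finset.smul_sum, dotProduct_smul, dotProduct_sum, smul_eq_mul, ← div_eq_inv_mul,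
      le_div_iff₀ hcard]
    by_cases hk : 0 ≤ p.kappa
    · nlinarith [mul_le_mul_of_nonneg_left hcard2 hk]
    · nlinarith

theorem exists_isNearOptimal {h : List (Round A S)} [Finite A]
    (hne : (p.admissiblePlans h).Nonempty) : ∃ π, p.IsNearOptimal h π := by
  classical
  have hbdd : BddAbove (p.index h '' p.admissiblePlans h) := by
    refine ⟨(h.map fun ρ => |ρ.reward|).sum + |p.bonus * (radius h.length + 1)|, ?_⟩
    rintro _ ⟨π, hπ, rfl⟩
    have hn : (1 : ℝ) ≤ actionCount π.target h + 1 := by simp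
    have hs0 : 0 ≤ (h.map fun ρ => |ρ.reward|).sum := List.sum_nonneg (by simp)
    refine add_le_add ?_ ?_
    · rw [div_le_iff₀ (by linarith)]
      refine le_trans (b := (h.map fun ρ => |ρ.reward|).sum) ?_ (by nlinarith)
      refine List.sum_le_sum fun ρ _ => ?_
      split_ifs
      · have := (hπ.2.2.1 ρ.outcome).1
        linarith [le_abs_self ρ.reward]
      · positivity
    · rw [div_le_iff₀ (by positivity)]
      have h1 : 1 ≤ √((actionCount π.target h : ℝ) + 1) := Real.one_le_sqrt.2 hn
      nlinarith [le_abs_self (p.bonus * (radius h.length + 1)),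
        abs_nonneg (p.bonus * (radius h.length + 1))]
  have hg : 0 < gap h.length := by unfold gap; positivity
  obtain ⟨_, ⟨π, hπ, rfl⟩, hlt⟩ := exists_lt_of_lt_csSup (hne.image (p.index h))
    (sub_lt_self (sSup (p.index h '' p.admissiblePlans h)) hg)
  refine ⟨π, hπ, fun π' hπ' => ?_⟩
  have := le_csSup hbdd ⟨π', hπ', rfl⟩
  linarith

theorem gap_pos (t : ℕ) : 0 < gap t := by unfold gap; positivity

theorem gap_le_one (t : ℕ) : gap t ≤ 1 := by
  unfold gap
  rw [div_le_one (by positivity)]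
  exact Real.one_le_sqrt.2 (by simp)

theorem le_gap (t : ℕ) : 1 / (2 : ℝ) ^ (Nat.log 2 (t + 1) + 1) ≤ gap t := by
  unfold gap
  refine one_div_le_one_div_of_le (by positivity) ?_
  have h1 : t + 1 < 2 ^ (Nat.log 2 (t + 1) + 1) := Nat.lt_pow_succ_log_self (by norm_num) _
  have h2 : (t + 1 : ℝ) ≤ 2 ^ (Nat.log 2 (t + 1) + 1) := by exact_mod_cast h1.le
  refine le_trans ?_ h2
  rw [Real.sqrt_le_left (by positivity)]
  nlinarith [(Nat.cast_nonneg t : (0:ℝ) ≤ t)]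

variable [Nonempty A]

theorem isNearOptimal_plan {h : List (Round A S)} [Finite A]
    (hne : (p.admissiblePlans h).Nonempty) : p.IsNearOptimal h (p.plan h) :=
  Classical.epsilon_spec (p.exists_isNearOptimal hne)

theorem learner_mem (hη : 0 ≤ p.eta) (h : List (Round A S)) :
    p.learner h ∈ contractSpace S p.eta := by
  unfold learner
  split_ifs with hx
  · exact hx
  · exact fun s => ⟨le_rfl, hη⟩

theorem phase_eq_none_of_length_le {g : List (Round A S)}
    (hg : g.length ≤ (probes S p.eta).length) : p.phase g = none := by
  induction g with
  | nil => rfl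
  | cons ρ g ih =>
    rw [List.length_cons] at hg
    rw [phase, ih (by omega)]
    simp only
    rw [if_pos (Or.inl (by omega))]

end LearnerParams

/-! ### The true model survives and all probes are posted -/

namespace ContractualBandit

open LearnerParams

variable {A S : Type*} [Fintype S] [Nonempty A] {M : ContractualBandit A S} {β : (S → ℝ) → A}
  {p : LearnerParams A} {h : List (Round A S)}

theorem Plays.mem_versionSpace (hη : 0 ≤ p.eta) (hc : M.cost = p.cost) (hi : M.Inducible p.lam)
    (hβ : M.IsBestResponse p.eta β) (hp : M.Plays β p.learner h) : M.P ∈ p.versionSpace h := by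
  refine ⟨M.P_mem, hi, ?_⟩
  induction hp with
  | nil => simp
  | @snoc h s _ ih =>
    intro ρ hρ a'
    rcases List.mem_append.1 hρ with hρ | hρ
    · exact ih ρ hρ a'
    · rw [List.mem_singleton.1 hρ]
      have := hβ _ (p.learner_mem hη h) a'
      rw [hc] at this
      simp only [sub_dotProduct]
      linarith

theorem Plays.exists_probe (hη : 0 ≤ p.eta) (hp : M.Plays β p.learner h) :
    ∀ i (hi : i < (probes S p.eta).length), i < h.length →
      ∃ ρ ∈ h, ρ.contract = (probes S p.eta)[i] := by
  induction hp with
  | nil => simp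
  | @snoc h s _ ih =>
    intro i hi hlt
    rw [List.length_append, List.length_singleton] at hlt
    rcases Nat.lt_succ_iff_lt_or_eq.1 hlt with hlt | rfl
    · obtain ⟨ρ, hρ, hx⟩ := ih i hi hlt
      exact ⟨ρ, List.mem_append_left _ hρ, hx⟩
    · refine ⟨_, List.mem_append_right _ (List.mem_singleton_self _), ?_⟩
      have hprop : p.proposal h = (probes S p.eta)[h.length] := by
        unfold proposal
        rw [p.phase_eq_none_of_length_le (by simpa using hi.le)]
        simp [hi]
      have hmem := probes_mem_contractSpace hη (List.getElem_mem hi)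
      simp only [learner, hprop, hmem, if_true]

end ContractualBandit

/-! ### Searches and their records -/

/-- Two collections of distributions, compared entry by entry. -/
def modelError {A S : Type*} (Q P : A → S → ℝ) : A × S → ℝ := fun i => Q i.1 i.2 - P i.1 i.2

open Classical in
/-- The vector whose product with the entries of `Q` is `(Q a - Q a') ⬝ᵥ y`. -/
noncomputable def comparisonVector {A S : Type*} (a a' : A) (y : S → ℝ) : A × S → ℝ := fun i =>
  (if i.1 = a then y i.2 else 0) - (if i.1 = a' then y i.2 else 0)

/-- The agent's comparisons are linear in the model, so errors and comparisons pair in a space of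
dimension `|A| |S|`. -/
theorem modelError_dotProduct_comparisonVector {A S : Type*} [Fintype A] [Fintype S]
    (Q P : A → S → ℝ) (a a' : A) (y : S → ℝ) :
    modelError Q P ⬝ᵥ comparisonVector a a' y =
      (Q a - Q a') ⬝ᵥ y - (P a - P a') ⬝ᵥ y := by
  classical
  have key : ∀ b : A, ∑ x : A, ∑ s, (Q x s - P x s) * (if x = b then y s else 0) =
      Q b ⬝ᵥ y - P b ⬝ᵥ y := by
    intro b
    rw [Finset.sum_eq_single b (fun x _ hx => by simp [hx]) (by simp)]
    simp [dotProduct, sub_mul, Finset.sum_sub_distrib]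
  simp only [dotProduct, modelError, comparisonVector, Fintype.sum_prod_type, mul_sub,
    Finset.sum_sub_distrib]
  have e1 := key a
  have e2 := key a'
  simp only [dotProduct] at e1 e2
  rw [e1, e2]
  simp only [Pi.sub_apply, sub_mul, Finset.sum_sub_distrib]
  ring

/-- What a finished search leaves behind: its level, the comparison that it pinned down, and the
error of the plan's model. -/
structure SearchRecord (A S : Type*) where
  level : ℕ
  feature : A × S → ℝ
  error : A × S → ℝ

theorem List.length_eq_sum_countP {α : Type*} (f : α → ℕ) (K : ℕ) (L : List α)
    (hL : ∀ r ∈ L, f r ≤ K) : L.length = ∑ k ∈ Finset.range (K + 1), L.countP (f · = k) := by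
  induction L with
  | nil => simp
  | cons r L ih =>
    have hr : f r < K + 1 := Nat.lt_succ_of_le (hL r (by simp))
    simp only [List.length_cons, List.countP_cons, Finset.sum_add_distrib,
      ← ih fun r' hr' => hL r' (List.mem_cons_of_mem _ hr')]
    simp [Finset.sum_ite_eq, hr]

namespace LearnerParams

variable {A S : Type*} [Fintype S] (p : LearnerParams A)

/-- The precision reached by a search of level `k`. -/
noncomputable def tolerance (k : ℕ) : ℝ := 2 * p.eta / 2 ^ p.depth k

variable [Fintype A]

/-- The records `L` of the finished searches, newest first, are consistent with the history. -/
structure RecordsValid (P : A → S → ℝ) (h : List (Round A S)) (L : List (SearchRecord A S)) :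
    Prop where
  track : ∀ r ∈ L, ∀ Q ∈ p.versionSpace h, |modelError Q P ⬝ᵥ r.feature| ≤ p.tolerance r.level
  large : ∀ r ∈ L, p.kappa / 2 ^ (r.level + 1) ≤ r.error ⬝ᵥ r.feature
  error_eq : ∀ r ∈ L, ∃ Q, (∀ a, Q a ∈ stdSimplex ℝ S) ∧ r.error = modelError Q P
  feature_eq : ∀ r ∈ L, ∃ a a', ∃ y ∈ contractSpace S p.eta, r.feature = comparisonVector a a' y
  pairwise : L.Pairwise fun r r' => |r.error ⬝ᵥ r'.feature| ≤ p.tolerance r'.level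
  level_le : ∀ r ∈ L, r.level ≤ Nat.log 2 (h.length + 1)

/-- The search `σ`, in its `j`-th round, brackets the boundary of the contracts inducing its
target. -/
structure SearchValid (P : A → S → ℝ) (h : List (Round A S)) (L : List (SearchRecord A S))
    (j : ℕ) (σ : SegmentSearch A S) : Prop where
  model_mem : ∀ a, σ.plan.model a ∈ stdSimplex ℝ S
  base_mem : σ.plan.base ∈ contractSpace S p.eta
  goal_mem : σ.plan.goal ∈ contractSpace S p.eta
  base_margin : ∀ a', a' ≠ σ.plan.target → p.cost σ.plan.target - p.cost a' + p.kappa ≤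
    (σ.plan.model σ.plan.target - σ.plan.model a') ⬝ᵥ σ.plan.base
  goal_margin : ∀ a', p.cost σ.plan.target - p.cost a' ≤
    (σ.plan.model σ.plan.target - σ.plan.model a') ⬝ᵥ σ.plan.goal
  lo_nonneg : 0 ≤ σ.lo
  lo_le_hi : σ.lo ≤ σ.hi
  hi_le : σ.hi ≤ 1 - 1 / 2 ^ (σ.level + 1)
  width : (σ.hi - σ.lo) * 2 ^ p.depth σ.level ≤ 2 ^ σ.left
  lo_induces : ∀ Q ∈ p.versionSpace h, ∀ a', p.cost σ.plan.target - p.cost a' ≤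
    (Q σ.plan.target - Q a') ⬝ᵥ σ.plan.point σ.lo
  hi_deviates : ∃ a', a' ≠ σ.plan.target ∧ ∀ Q ∈ p.versionSpace h,
    (Q σ.plan.target - Q a') ⬝ᵥ σ.plan.point σ.hi ≤ p.cost σ.plan.target - p.cost a'
  level_le : σ.level ≤ Nat.log 2 (h.length + 1)
  count : j + σ.left = p.depth σ.level + 1
  model_track : ∀ r ∈ L, |modelError σ.plan.model P ⬝ᵥ r.feature| ≤ p.tolerance r.level

variable {p} {P : A → S → ℝ} {h : List (Round A S)} {L : List (SearchRecord A S)}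

theorem RecordsValid.append (hL : p.RecordsValid P h L) (ρ : Round A S) :
    p.RecordsValid P (h ++ [ρ]) L where
  track r hr Q hQ := hL.track r hr Q (p.versionSpace_append h ρ hQ)
  large := hL.large
  error_eq := hL.error_eq
  feature_eq := hL.feature_eq
  pairwise := hL.pairwise
  level_le r hr := (hL.level_le r hr).trans (Nat.log_mono_right (by simp))

theorem abs_modelError_le {Q : A → S → ℝ} (hQ : ∀ a, Q a ∈ stdSimplex ℝ S)
    (hP : ∀ a, P a ∈ stdSimplex ℝ S) {y : S → ℝ} {η : ℝ} (hy : y ∈ contractSpace S η) (a a' : A) :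
    |modelError Q P ⬝ᵥ comparisonVector a a' y| ≤ 2 * η := by
  rw [modelError_dotProduct_comparisonVector, sub_dotProduct, sub_dotProduct]
  have h1 := dotProduct_mem_Icc_of_mem_contractSpace (hQ a) hy
  have h2 := dotProduct_mem_Icc_of_mem_contractSpace (hQ a') hy
  have h3 := dotProduct_mem_Icc_of_mem_contractSpace (hP a) hy
  have h4 := dotProduct_mem_Icc_of_mem_contractSpace (hP a') hy
  rw [abs_le]
  constructor <;> linarith [h1.1, h1.2, h2.1, h2.2, h3.1, h3.2, h4.1, h4.2]

/-- There are at most `|A| |S|` searches per level. -/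
theorem RecordsValid.length_le (hL : p.RecordsValid P h L) (hP : ∀ a, P a ∈ stdSimplex ℝ S)
    (hη : 0 < p.eta) (hκ : 0 < p.kappa)
    (hdepth : ∀ k, ((Fintype.card (A × S) + 1).factorial : ℝ) *
      (p.tolerance k * (2 * p.eta) ^ Fintype.card (A × S)) <
      (p.kappa / 2 ^ (k + 1)) ^ (Fintype.card (A × S) + 1)) :
    L.length ≤ (Nat.log 2 (h.length + 1) + 1) * Fintype.card (A × S) := by
  rw [List.length_eq_sum_countP SearchRecord.level _ L hL.level_le]
  refine (Finset.sum_le_card_nsmul _ _ (Fintype.card (A × S)) fun k _ => ?_).trans (by simp)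
  rw [List.countP_eq_length_filter]
  set L' := L.filter (fun r => decide (r.level = k)) with hL'
  have hmem : ∀ i : Fin L'.length, L'.get i ∈ L ∧ (L'.get i).level = k := by
    intro i
    simpa using List.mem_filter.1 (L'.get_mem i)
  refine length_le_card_of_small_dotProduct (fun i => (L'.get i).error)
    (fun i => (L'.get i).feature) (ε := p.tolerance k) (R := 2 * p.eta)
    (by unfold tolerance; positivity) (G := p.kappa / 2 ^ (k + 1)) (by positivity)
    ?_ ?_ ?_ (hdepth k)
  · intro i j
    obtain ⟨Q, hQ, he⟩ := hL.error_eq _ (hmem i).1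
    obtain ⟨a, a', y, hy, hf⟩ := hL.feature_eq _ (hmem j).1
    rw [he, hf]
    exact abs_modelError_le hQ hP hy a a'
  · intro i j hij
    -- Records are listed newest first: for `i < j`, the model of record `i` was chosen when record
    -- `j` already constrained the version space.
    have := List.pairwise_iff_get.1 (hL.pairwise.filter (fun r => decide (r.level = k))) i j hij
    rw [← (hmem j).2]
    exact this
  · intro i
    have := hL.large _ (hmem i).1
    rwa [(hmem i).2] at this

/-- A finished search adds a record. -/
theorem SearchValid.exists_record {σ : SegmentSearch A S} {j : ℕ}
    (hσ : p.SearchValid P h L j σ) (hL : p.RecordsValid P h L) (hη : 0 < p.eta) (hκ : 0 < p.kappa)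
    (hP : P ∈ p.versionSpace h) (hleft : σ.left = 0) :
    ∃ r, p.RecordsValid P h (r :: L) := by
  obtain ⟨a', ha', hdev⟩ := hσ.hi_deviates
  have hhi1 : σ.hi ≤ 1 := hσ.hi_le.trans (by
    have : (0 : ℝ) ≤ 1 / 2 ^ (σ.level + 1) := by positivity
    linarith)
  have hmem : σ.plan.point σ.hi ∈ contractSpace S p.eta :=
    ContractPlan.point_mem hσ.base_mem hσ.goal_mem (hσ.lo_nonneg.trans hσ.lo_le_hi) hhi1
  have hw : (σ.hi - σ.lo) ≤ 1 / 2 ^ p.depth σ.level := by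
    rw [le_div_iff₀ (by positivity)]
    simpa [hleft] using hσ.width
  -- The target is optimal at `lo`, and going from `lo` to `hi` lowers the comparison by at most
  -- `(hi - lo) * 2 * eta`. Together with the deviation at `hi`, this pins the comparison at `hi` to
  -- within the tolerance.
  have hlower : ∀ Q ∈ p.versionSpace h, p.cost σ.plan.target - p.cost a' - p.tolerance σ.level ≤
      (Q σ.plan.target - Q a') ⬝ᵥ σ.plan.point σ.hi := by
    intro Q hQ
    have h1 := hσ.lo_induces Q hQ a'
    rw [ContractPlan.dotProduct_point] at h1 ⊢
    have b1 := dotProduct_mem_Icc_of_mem_contractSpace (hQ.1 σ.plan.target) hσ.base_mem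
    have b2 := dotProduct_mem_Icc_of_mem_contractSpace (hQ.1 a') hσ.base_mem
    have b3 := dotProduct_mem_Icc_of_mem_contractSpace (hQ.1 σ.plan.target) hσ.goal_mem
    have b4 := dotProduct_mem_Icc_of_mem_contractSpace (hQ.1 a') hσ.goal_mem
    rw [sub_dotProduct, sub_dotProduct] at h1 ⊢
    set u := Q σ.plan.target ⬝ᵥ σ.plan.base - Q a' ⬝ᵥ σ.plan.base
    set v := Q σ.plan.target ⬝ᵥ σ.plan.goal - Q a' ⬝ᵥ σ.plan.goal
    have huv : u - v ≤ 2 * p.eta := by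
      simp only [u, v]; linarith [b1.1, b1.2, b2.1, b2.2, b3.1, b3.2, b4.1, b4.2]
    have h3 : (σ.hi - σ.lo) * (u - v) ≤ p.tolerance σ.level := by
      calc (σ.hi - σ.lo) * (u - v) ≤ (σ.hi - σ.lo) * (2 * p.eta) :=
            mul_le_mul_of_nonneg_left huv (sub_nonneg.2 hσ.lo_le_hi)
        _ ≤ 1 / 2 ^ p.depth σ.level * (2 * p.eta) :=
            mul_le_mul_of_nonneg_right hw (by positivity)
        _ = p.tolerance σ.level := by unfold tolerance; ring
    linarith
  have hfeat : ∀ Q ∈ p.versionSpace h,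
      |modelError Q P ⬝ᵥ comparisonVector σ.plan.target a' (σ.plan.point σ.hi)| ≤
        p.tolerance σ.level := by
    intro Q hQ
    rw [modelError_dotProduct_comparisonVector, abs_le]
    constructor <;> linarith [hdev Q hQ, hdev P hP, hlower Q hQ, hlower P hP]
  refine ⟨⟨σ.level, comparisonVector σ.plan.target a' (σ.plan.point σ.hi),
    modelError σ.plan.model P⟩, ?_, ?_, ?_, ?_, ?_, ?_⟩
  · exact List.forall_mem_cons.2 ⟨hfeat, hL.track⟩
  · refine List.forall_mem_cons.2 ⟨?_, hL.large⟩
    simp only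
    -- Along the segment the margin in the refuted model interpolates from at least `kappa` at the
    -- base to at least `0` at the goal, so `(1 - hi) * kappa` remains at `hi`; under `P` the margin
    -- there is at most `0`.
    rw [modelError_dotProduct_comparisonVector, ContractPlan.dotProduct_point]
    have h1 := hσ.base_margin a' ha'
    have h2 := hσ.goal_margin a'
    have h3 := hdev P hP
    have h4 := mul_le_mul_of_nonneg_left h1 (sub_nonneg.2 hhi1)
    have h5 := mul_le_mul_of_nonneg_left h2 (hσ.lo_nonneg.trans hσ.lo_le_hi)
    have h6 : 1 / 2 ^ (σ.level + 1) * p.kappa ≤ (1 - σ.hi) * p.kappa :=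
      mul_le_mul_of_nonneg_right (by linarith [hσ.hi_le]) hκ.le
    rw [div_eq_mul_one_div, mul_comm]
    linarith
  · exact List.forall_mem_cons.2 ⟨⟨_, hσ.model_mem, rfl⟩, hL.error_eq⟩
  · exact List.forall_mem_cons.2 ⟨⟨_, _, _, hmem, rfl⟩, hL.feature_eq⟩
  · exact List.pairwise_cons.2 ⟨hσ.model_track, hL.pairwise⟩
  · exact List.forall_mem_cons.2 ⟨hσ.level_le, hL.level_le⟩

/-- A search continues to bracket the boundary after the agent's answer to the midpoint. -/
theorem SearchValid.step {σ σ' : SegmentSearch A S} {j : ℕ} (hσ : p.SearchValid P h L j σ)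
    {ρ : Round A S} (hρ : ρ.contract = σ.plan.point σ.mid) (hnext : σ.next ρ.action = some σ') :
    p.SearchValid P (h ++ [ρ]) L (j + 1) σ' := by
  have hV := p.versionSpace_append h ρ
  have hlog : Nat.log 2 (h.length + 1) ≤ Nat.log 2 ((h ++ [ρ]).length + 1) :=
    Nat.log_mono_right (by simp)
  have hmid : σ.mid = (σ.lo + σ.hi) / 2 := rfl
  have hle := hσ.lo_le_hi
  unfold SegmentSearch.next at hnext
  by_cases hl : σ.left = 0
  · simp [hl] at hnext
  have hpow : (2 : ℝ) ^ σ.left = 2 * 2 ^ (σ.left - 1) := by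
    rw [← pow_succ']; congr 1; omega
  have hcount := hσ.count
  have hwidth := hσ.width
  rw [if_neg hl] at hnext
  split_ifs at hnext with ha
  · obtain rfl := Option.some.inj hnext
    refine ⟨hσ.model_mem, hσ.base_mem, hσ.goal_mem, hσ.base_margin, hσ.goal_margin, ?_, ?_,
      hσ.hi_le, ?_, ?_, ?_, hσ.level_le.trans hlog, ?_, hσ.model_track⟩
    · simp only; linarith [hσ.lo_nonneg]
    · simp only; linarith
    · simp only; rw [hmid]; nlinarith
    · intro Q hQ a'
      have := hQ.2.2 ρ (by simp) a'
      rwa [ha, hρ] at this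
    · obtain ⟨a', ha', hd⟩ := hσ.hi_deviates
      exact ⟨a', ha', fun Q hQ => hd Q (hV hQ)⟩
    · simp only; omega
  · obtain rfl := Option.some.inj hnext
    refine ⟨hσ.model_mem, hσ.base_mem, hσ.goal_mem, hσ.base_margin, hσ.goal_margin,
      hσ.lo_nonneg, ?_, ?_, ?_, fun Q hQ => hσ.lo_induces Q (hV hQ), ?_,
      hσ.level_le.trans hlog, ?_, hσ.model_track⟩
    · simp only; linarith
    · simp only; linarith [hσ.hi_le]
    · simp only; rw [hmid]; nlinarith
    · refine ⟨ρ.action, ha, fun Q hQ => ?_⟩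
      have := hQ.2.2 ρ (by simp) σ.plan.target
      rw [hρ, sub_dotProduct] at this
      rw [sub_dotProduct]
      linarith
    · simp only; omega

/-- A deviation from a plan's contract starts a valid search. -/
theorem searchValid_start {π : ContractPlan A S} (hπ : π ∈ p.admissiblePlans h)
    (hL : p.RecordsValid P h L) (hκ : 0 ≤ p.kappa) {ρ : Round A S}
    (hρ : ρ.contract = π.point (1 - gap h.length)) (ha : ρ.action ≠ π.target) :
    p.SearchValid P (h ++ [ρ]) L 1 ⟨π, 0, 1 - gap h.length, Nat.log 2 (h.length + 1),
      p.depth (Nat.log 2 (h.length + 1))⟩ := by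
  obtain ⟨hbase, hmodel, hgoal, hgm⟩ := hπ
  have hg1 := gap_le_one h.length
  have hg0 := gap_pos h.length
  have hlog : Nat.log 2 (h.length + 1) ≤ Nat.log 2 ((h ++ [ρ]).length + 1) :=
    Nat.log_mono_right (by simp)
  refine ⟨hmodel.1, hbase.1, hgoal, hbase.2 _ hmodel, hgm, le_rfl, by simpa using hg1, ?_, ?_, ?_,
    ?_, hlog, Nat.add_comm _ _, fun r hr => hL.track r hr _ hmodel⟩
  · simp only
    linarith [le_gap h.length]
  · simp only [sub_zero]
    have : (0 : ℝ) < 2 ^ p.depth (Nat.log 2 (h.length + 1)) := by positivity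
    nlinarith
  -- At `lo = 0` the point is the base, where robustness replaces an observed answer.
  · intro Q hQ a'
    have hpt : π.point 0 = π.base := by simp [ContractPlan.point]
    simp only [hpt]
    rcases eq_or_ne a' π.target with rfl | hne
    · simp
    · linarith [hbase.2 Q (p.versionSpace_append h ρ hQ) a' hne]
  · refine ⟨ρ.action, ha, fun Q hQ => ?_⟩
    have := hQ.2.2 ρ (by simp) π.target
    rw [hρ, sub_dotProduct] at this
    simp only [sub_dotProduct]
    linarith

end LearnerParams

/-! ### Optimistic plans and the accounting of lost rounds -/

namespace ContractualBandit

open LearnerParams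

variable {A S : Type*} [Fintype S] {M : ContractualBandit A S}
  {β : (S → ℝ) → A} {p : LearnerParams A} {h : List (Round A S)}

/-- Without this, `leastPayment` could be the default infimum `0` of an empty set. -/
theorem inducingContracts_nonempty (hη : 0 < p.eta)
    (hmargin : ∀ a a', p.cost a - p.cost a' ≤ p.lam * p.eta) (hc : M.cost = p.cost)
    (hi : M.Inducible p.lam) (a : A) : (M.inducingContracts p.eta a).Nonempty := by
  obtain ⟨e, he, hlam⟩ := hi a
  refine ⟨p.eta • e, fun s => ?_, fun a' ha' => ?_⟩
  · rcases he s with h0 | h0 <;> simp [h0, hη.le]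
  · rw [dotProduct_smul, smul_eq_mul, hc]
    have := mul_le_mul_of_nonneg_left (hlam a' ha') hη.le
    linarith [hmargin a a']

variable [Nonempty A]

/-- Optimism: the true model survives, so every truly inducing contract is the goal of some
admissible plan. -/
theorem Plays.admissiblePlans_nonempty {δ : ℝ} (hη : 0 < p.eta) (hδ : 0 < δ)
    (hmargin : ∀ a a', p.cost a - p.cost a' + δ ≤ p.lam * p.eta)
    (hκ : p.kappa * (2 : ℝ) ^ Fintype.card S ≤ δ) (hc : M.cost = p.cost) (hi : M.Inducible p.lam)
    (hβ : M.IsBestResponse p.eta β) (hp : M.Plays β p.learner h)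
    (hlen : (probes S p.eta).length ≤ h.length) {a : A} {x : S → ℝ}
    (hx : x ∈ M.inducingContracts p.eta a) :
    ∃ π ∈ p.admissiblePlans h, π.target = a ∧ π.goal = x := by
  have hV := hp.mem_versionSpace hη.le hc hi hβ
  obtain ⟨b, hb⟩ := p.robustContracts_nonempty hη hδ hmargin hκ ⟨_, hV⟩ (fun x hx => by
    obtain ⟨i, hi, rfl⟩ := List.getElem_of_mem hx
    exact hp.exists_probe hη.le i hi (by omega)) a
  refine ⟨⟨a, b, M.P, x⟩, ⟨hb, hV, hx.1, fun a' => ?_⟩, rfl, rfl⟩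
  rcases eq_or_ne a' a with rfl | hne
  · simp
  · have := hx.2 a' hne
    rwa [hc] at this

/-- Outside searches, after the initial rounds, the learner posts the contract of a near-optimal
plan. -/
theorem learner_eq_of_phase_none (hplan : p.IsNearOptimal h (p.plan h))
    (hlen : (probes S p.eta).length ≤ h.length) (hphase : p.phase h.reverse = none) :
    p.learner h = (p.plan h).point (1 - gap h.length) := by
  have hprop : p.proposal h = (p.plan h).point (1 - gap h.length) := by
    unfold proposal
    rw [hphase]
    simp [not_lt.2 hlen]
  have hg1 := gap_le_one h.length
  have hg0 := gap_pos h.length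
  have hmem := ContractPlan.point_mem hplan.1.1.1 hplan.1.2.2.1
    (sub_nonneg.2 hg1) (by linarith : 1 - gap h.length ≤ 1)
  simp only [learner, hprop, hmem, if_true]

variable [Fintype A]

/-- The bookkeeping of searches: finished ones are on record, the lost rounds are paid for. -/
theorem Plays.exists_records (hη : 0 < p.eta) (hκ : 0 < p.kappa) (hmono : Monotone p.depth)
    (hc : M.cost = p.cost) (hi : M.Inducible p.lam) (hβ : M.IsBestResponse p.eta β)
    (hplan : ∀ g, M.Plays β p.learner g → (probes S p.eta).length ≤ g.length →
      p.IsNearOptimal g (p.plan g))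
    (hp : M.Plays β p.learner h) :
    ∃ L j, p.RecordsValid M.P h L ∧
      lostRounds p h.reverse ≤ L.length * (p.depth (Nat.log 2 (h.length + 1)) + 2) + j ∧
      (p.phase h.reverse = none → j = 0) ∧
      (∀ σ, p.phase h.reverse = some σ → p.SearchValid M.P h L j σ) := by
  induction hp with
  | nil =>
    refine ⟨[], 0, ⟨by simp, by simp, by simp, by simp, by simp, by simp⟩, by simp [lostRounds],
      by simp, by simp [phase]⟩
  | @snoc h s hp ih =>
    obtain ⟨L, j, hL, hlost, hnone, hsome⟩ := ih
    set ρ : Round A S := ⟨p.learner h, β (p.learner h), s, M.reward s⟩ with hρ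
    have hp' : M.Plays β p.learner (h ++ [ρ]) := hp.snoc s
    have hP' := hp'.mem_versionSpace hη.le hc hi hβ
    have hd : p.depth (Nat.log 2 (h.length + 1)) ≤
        p.depth (Nat.log 2 ((h ++ [ρ]).length + 1)) := hmono (Nat.log_mono_right (by simp))
    have hlost' : lostRounds p h.reverse ≤
        L.length * (p.depth (Nat.log 2 ((h ++ [ρ]).length + 1)) + 2) + j :=
      hlost.trans (by gcongr)
    have hrev : (h ++ [ρ]).reverse = ρ :: h.reverse := by simp
    rw [hrev]
    simp only [phase, lostRounds]
    rcases hph : p.phase h.reverse with _ | σ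
    · obtain rfl := hnone hph
      simp only [Option.isSome_none, Bool.false_eq_true, false_or, List.length_reverse,
        List.reverse_reverse]
      by_cases hlen : (probes S p.eta).length ≤ h.length
      · by_cases ha : ρ.action = (p.plan h).target
        · refine ⟨L, 0, hL.append ρ, ?_, by simp, by simp [ha]⟩
          simpa [ha] using hlost'
        · have hpl := hplan h hp hlen
          have hx : ρ.contract = (p.plan h).point (1 - gap h.length) :=
            learner_eq_of_phase_none hpl hlen hph
          refine ⟨L, 1, hL.append ρ, ?_, by simp [ha, not_lt.2 hlen], ?_⟩
          · simpa [ha, hlen] using hlost'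
          · intro σ hσ
            rw [if_neg (by simp [ha, hlen])] at hσ
            obtain rfl := Option.some.inj hσ
            exact searchValid_start hpl.1 hL hκ.le hx ha
      · refine ⟨L, 0, hL.append ρ, ?_, by simp [not_le.1 hlen], by simp [not_le.1 hlen]⟩
        simpa [hlen] using hlost'
    · have hσ := hsome σ hph
      have hmidmem : σ.plan.point σ.mid ∈ contractSpace S p.eta := by
        have h1 := hσ.lo_nonneg
        have h2 := hσ.lo_le_hi
        have h3 := hσ.hi_le
        have h4 : (0 : ℝ) ≤ 1 / 2 ^ (σ.level + 1) := by positivity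
        refine ContractPlan.point_mem hσ.base_mem hσ.goal_mem ?_ ?_ <;>
          unfold SegmentSearch.mid <;> linarith
      have hprop : p.proposal h = σ.plan.point σ.mid := by
        unfold proposal
        rw [hph]
      have hx : ρ.contract = σ.plan.point σ.mid := by
        simp only [hρ, learner, hprop, hmidmem, if_true]
      simp only [Option.isSome_some, true_or, if_true]
      rcases hnx : σ.next ρ.action with _ | σ'
      · have hleft : σ.left = 0 := by
          by_contra hne
          unfold SegmentSearch.next at hnx
          rw [if_neg hne] at hnx
          split_ifs at hnx
        obtain ⟨r, hr⟩ := hσ.exists_record hL hη hκ (hp.mem_versionSpace hη.le hc hi hβ) hleft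
        refine ⟨r :: L, 0, hr.append ρ, ?_, by simp, by simp⟩
        have hcount := hσ.count
        have hmon := hmono hσ.level_le
        rw [List.length_cons, Nat.succ_mul]
        omega
      · exact ⟨L, j + 1, hL.append ρ, by omega, by simp, fun τ hτ => by
          obtain rfl := Option.some.inj hτ
          exact hσ.step hx hnx⟩

end ContractualBandit

/-! ### Concentration by exponential supermartingales -/

section Statistics

variable {A S : Type*}

open Classical in
/-- The excess of the number of outcomes `s` over its mean, in the rounds with action `a`. -/
noncomputable def outcomeDeviation (P : A → S → ℝ) (a : A) (s : S) (h : List (Round A S)) : ℝ :=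
  (h.map fun ρ => if ρ.action = a then (if ρ.outcome = s then 1 else 0) - P a s else 0).sum

/-- An exponential supermartingale for `outcomeDeviation`. -/
noncomputable def expDeviation (P : A → S → ℝ) (a : A) (s : S) (r : ℝ) (h : List (Round A S)) : ℝ :=
  Real.exp (r * outcomeDeviation P a s h - r ^ 2 * actionCount a h)

open Classical in
theorem actionCount_append (a : A) (h : List (Round A S)) (ρ : Round A S) :
    actionCount a (h ++ [ρ]) = actionCount a h + if ρ.action = a then 1 else 0 := by
  simp [actionCount]

open Classical in
theorem outcomeDeviation_append (P : A → S → ℝ) (a : A) (s : S) (h : List (Round A S))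
    (ρ : Round A S) : outcomeDeviation P a s (h ++ [ρ]) = outcomeDeviation P a s h +
      if ρ.action = a then (if ρ.outcome = s then 1 else 0) - P a s else 0 := by
  simp [outcomeDeviation]

theorem actionCount_le_length (a : A) (h : List (Round A S)) : actionCount a h ≤ h.length := by
  classical
  induction h using List.reverseRecOn with
  | nil => simp [actionCount]
  | append_singleton h ρ ih =>
    rw [actionCount_append, List.length_append, List.length_singleton]
    split_ifs <;> omega

theorem le_one_of_mem_stdSimplex [Fintype S] {q : S → ℝ} (hq : q ∈ stdSimplex ℝ S) (s : S) :
    q s ≤ 1 := by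
  rw [← hq.2]
  exact Finset.single_le_sum (fun i _ => hq.1 i) (Finset.mem_univ s)

theorem abs_indicator_sub_le [Fintype S] {q : S → ℝ} (hq : q ∈ stdSimplex ℝ S) (s s' : S)
    [Decidable (s' = s)] : |(if s' = s then 1 else 0) - q s| ≤ 1 := by
  have h0 := hq.1 s
  have h1 := le_one_of_mem_stdSimplex hq s
  rw [abs_le]
  split_ifs <;> constructor <;> linarith

theorem abs_outcomeDeviation_le [Fintype S] {P : A → S → ℝ} (hP : ∀ a, P a ∈ stdSimplex ℝ S)
    (a : A) (s : S) (h : List (Round A S)) : |outcomeDeviation P a s h| ≤ actionCount a h := by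
  classical
  induction h using List.reverseRecOn with
  | nil => simp [outcomeDeviation]
  | append_singleton h ρ ih =>
    rw [actionCount_append, outcomeDeviation_append]
    by_cases ha : ρ.action = a
    · rw [if_pos ha, if_pos ha]
      push_cast
      exact (abs_add_le _ _).trans (add_le_add ih (abs_indicator_sub_le (hP a) s ρ.outcome))
    · simpa [ha] using ih

variable [Fintype S]

/-- The bound `exp x ≤ 1 + x + x ^ 2` for `|x| ≤ 1`, a centered indicator, and `1 + r ^ 2 ≤ exp (r ^
2)`. -/
theorem sum_mul_exp_le_one {q : S → ℝ} (hq : q ∈ stdSimplex ℝ S) (s : S) [DecidableEq S] {r : ℝ}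
    (hr : |r| ≤ 1) :
    ∑ s', q s' * Real.exp (r * ((if s' = s then 1 else 0) - q s) - r ^ 2) ≤ 1 := by
  have hterm : ∀ s', q s' * Real.exp (r * ((if s' = s then 1 else 0) - q s) - r ^ 2) ≤
      Real.exp (-r ^ 2) * (q s' + r * (q s' * (if s' = s then 1 else 0) - q s' * q s) +
        q s' * r ^ 2) := by
    intro s'
    have hd := abs_indicator_sub_le hq s s'
    set d : ℝ := (if s' = s then 1 else 0) - q s with hdd
    have hrd : |r * d| ≤ 1 := by
      rw [abs_mul]; exact mul_le_one₀ hr (abs_nonneg _) hd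
    have h1 := (abs_le.1 (Real.abs_exp_sub_one_sub_id_le hrd)).2
    have h2 : (r * d) ^ 2 ≤ r ^ 2 := by
      rw [mul_pow]
      have : d ^ 2 ≤ 1 := (sq_le_one_iff_abs_le_one d).2 hd
      nlinarith [sq_nonneg r]
    rw [sub_eq_add_neg, Real.exp_add]
    have h3 : Real.exp (r * d) ≤ 1 + r * d + r ^ 2 := by linarith
    calc q s' * (Real.exp (r * d) * Real.exp (-r ^ 2))
        ≤ q s' * ((1 + r * d + r ^ 2) * Real.exp (-r ^ 2)) := by
          have := hq.1 s'
          gcongr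
      _ = _ := by rw [hdd]; ring
  refine (Finset.sum_le_sum fun s' _ => hterm s').trans ?_
  rw [← Finset.mul_sum, Finset.sum_add_distrib, Finset.sum_add_distrib, ← Finset.mul_sum,
    Finset.sum_sub_distrib, ← Finset.sum_mul, ← Finset.sum_mul, hq.2]
  simp only [mul_ite, mul_one, mul_zero, Finset.sum_ite_eq', Finset.mem_univ, if_true, one_mul,
    sub_self, add_zero]
  rw [Real.exp_neg, inv_mul_le_iff₀ (Real.exp_pos _), mul_one]
  linarith [Real.add_one_le_exp (r ^ 2)]

theorem sum_mul_expDeviation_append_le {P : A → S → ℝ} (hP : ∀ a, P a ∈ stdSimplex ℝ S) (a : A)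
    (s : S) {r : ℝ} (hr : |r| ≤ 1) (h : List (Round A S)) (x : S → ℝ) (b : A) (ι : S → ℝ) :
    ∑ s', P b s' * expDeviation P a s r (h ++ [⟨x, b, s', ι s'⟩]) ≤ expDeviation P a s r h := by
  classical
  simp only [expDeviation, actionCount_append, outcomeDeviation_append]
  by_cases hb : b = a
  · subst hb
    simp only [if_true]
    have hfac : ∀ s', P b s' * Real.exp (r * (outcomeDeviation P b s h +
        ((if s' = s then 1 else 0) - P b s)) - r ^ 2 * ((actionCount b h + 1 : ℕ) : ℝ)) =
        Real.exp (r * outcomeDeviation P b s h - r ^ 2 * actionCount b h) *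
          (P b s' * Real.exp (r * ((if s' = s then 1 else 0) - P b s) - r ^ 2)) := by
      intro s'
      rw [mul_left_comm, ← Real.exp_add]
      push_cast
      ring_nf
    rw [Finset.sum_congr rfl fun s' _ => hfac s', ← Finset.mul_sum]
    exact mul_le_of_le_one_right (Real.exp_pos _).le (sum_mul_exp_le_one (hP b) s hr)
  · simp only [hb, if_false, add_zero]
    rw [← Finset.sum_mul, (hP b).2, one_mul]

end Statistics

namespace LearnerParams

variable {A S : Type*} [Fintype A] [Fintype S]

/-- The exponents used in round `t`, for an action taken `m` times. -/
noncomputable def tilt (t m : ℕ) : ℝ := min 1 (radius t / (2 * √(m + 1)))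

/-- At least `1` whenever some deviation exceeds the confidence radius of round `t`, and small on
average. -/
noncomputable def penalty (P : A → S → ℝ) (t : ℕ) (h : List (Round A S)) : ℝ :=
  ∑ a, ∑ s, ∑ m ∈ Finset.range (t + 1),
    1 / ((t : ℝ) + 2) ^ 4 * (expDeviation P a s (tilt t m) h + expDeviation P a s (-tilt t m) h)

theorem penalty_nonneg (P : A → S → ℝ) (t : ℕ) (h : List (Round A S)) : 0 ≤ penalty P t h := by
  unfold penalty expDeviation
  positivity

theorem radius_nonneg (t : ℕ) : 0 ≤ radius t := by unfold radius; positivity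

theorem radius_mono : Monotone radius := by
  intro t t' h
  unfold radius
  have : (t : ℝ) ≤ t' := by exact_mod_cast h
  gcongr

theorem abs_tilt_le (t m : ℕ) : |tilt t m| ≤ 1 := by
  rw [abs_of_nonneg]
  · exact min_le_left _ _
  · exact le_min zero_le_one (div_nonneg (radius_nonneg t) (by positivity))

/-- The best exponent depends on the count, which is random, whereas the supermartingale needs a
fixed one. The penalty therefore sums over all possible counts `m`, and the term with the actual
count is already at least `1`. -/
theorem one_le_penalty {P : A → S → ℝ} (hP : ∀ a, P a ∈ stdSimplex ℝ S) {h : List (Round A S)}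
    {a : A} {s : S} (hdev : radius h.length * √(actionCount a h + 1) < |outcomeDeviation P a s h|) :
    1 ≤ penalty P h.length h := by
  set t := h.length with ht
  set n := actionCount a h with hn
  set X := outcomeDeviation P a s h with hX
  have hnt : n ≤ t := actionCount_le_length a h
  have hsq : 0 < √((n : ℝ) + 1) := by positivity
  have hsq2 : √((n : ℝ) + 1) ^ 2 = n + 1 := Real.sq_sqrt (by positivity)
  have hXn : |X| ≤ n := abs_outcomeDeviation_le hP a s h
  have hθ := radius_nonneg t
  -- A deviation never exceeds the count, so a violation forces this and the cap `1` in `tilt` is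
  -- inactive.
  have hlt : radius t < √((n : ℝ) + 1) := by
    by_contra! hcon
    nlinarith
  have htilt : tilt t n = radius t / (2 * √(n + 1)) := by
    refine min_eq_right ?_
    rw [div_le_one (by positivity)]
    linarith
  have hθ2 : radius t ^ 2 = 16 * Real.log (t + 2) := by
    unfold radius
    rw [mul_pow, Real.sq_sqrt (Real.log_nonneg (by linarith [(Nat.cast_nonneg t : (0:ℝ) ≤ t)]))]
    norm_num
  -- The exponent is at least `radius ^ 2 / 2 - radius ^ 2 / 4 = 4 * log (t + 2)`, which cancels the
  -- weight `(t + 2) ^ (-4)`.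
  have hexp : 4 * Real.log (t + 2) ≤ tilt t n * |X| - tilt t n ^ 2 * n := by
    have h1 : tilt t n * √((n : ℝ) + 1) = radius t / 2 := by
      rw [htilt]; field_simp
    have h0 : 0 ≤ tilt t n := by rw [htilt]; positivity
    have h2 : tilt t n * (radius t * √((n : ℝ) + 1)) ≤ tilt t n * |X| :=
      mul_le_mul_of_nonneg_left hdev.le h0
    have h3 : tilt t n ^ 2 * (n + 1) = radius t ^ 2 / 4 := by
      rw [← hsq2, ← mul_pow, h1]; ring
    have h4 : tilt t n * (radius t * √((n : ℝ) + 1)) = radius t ^ 2 / 2 := by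
      rw [mul_left_comm, h1]; ring
    nlinarith [sq_nonneg (tilt t n)]
  have hbig : ((t : ℝ) + 2) ^ 4 ≤
      expDeviation P a s (tilt t n) h + expDeviation P a s (-tilt t n) h := by
    have h5 : ((t : ℝ) + 2) ^ 4 = Real.exp (4 * Real.log (t + 2)) := by
      rw [mul_comm, Real.exp_mul, Real.exp_log (by positivity)]
      norm_cast
    rw [h5]
    rcases abs_cases X with ⟨hc, -⟩ | ⟨hc, -⟩ <;> rw [hc] at hexp
    · refine le_add_of_le_of_nonneg (Real.exp_le_exp.2 hexp) (Real.exp_pos _).le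
    · refine le_add_of_nonneg_of_le (Real.exp_pos _).le (Real.exp_le_exp.2 ?_)
      rw [neg_sq, neg_mul, ← mul_neg]
      exact hexp
  let F : A → S → ℕ → ℝ := fun a s m =>
    1 / ((t : ℝ) + 2) ^ 4 * (expDeviation P a s (tilt t m) h + expDeviation P a s (-tilt t m) h)
  have hpos : ∀ a s m, 0 ≤ F a s m := fun a s m => by simp only [F, expDeviation]; positivity
  calc (1 : ℝ) ≤ F a s n := by
        simp only [F]
        rw [one_div, ← div_eq_inv_mul, le_div_iff₀ (by positivity), one_mul]; exact hbig
    _ ≤ ∑ m ∈ Finset.range (t + 1), F a s m :=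
      Finset.single_le_sum (f := fun m => F a s m) (fun m _ => hpos a s m)
        (Finset.mem_range.2 (Nat.lt_succ_of_le hnt))
    _ ≤ ∑ s, ∑ m ∈ Finset.range (t + 1), F a s m :=
      Finset.single_le_sum (f := fun s => ∑ m ∈ Finset.range (t + 1), F a s m)
        (fun s _ => Finset.sum_nonneg fun m _ => hpos a s m) (Finset.mem_univ s)
    _ ≤ penalty P t h :=
      Finset.single_le_sum (f := fun a => ∑ s, ∑ m ∈ Finset.range (t + 1), F a s m)
        (fun a _ => Finset.sum_nonneg fun s _ => Finset.sum_nonneg fun m _ => hpos a s m)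
        (Finset.mem_univ a)

end LearnerParams

namespace ContractualBandit

open LearnerParams

variable {A S : Type*} [Fintype S] {M : ContractualBandit A S}
  {β : (S → ℝ) → A} {p : LearnerParams A} {h : List (Round A S)}

/-- The principal's expected utility from action `a` under contract `x`. -/
noncomputable def utility (M : ContractualBandit A S) (a : A) (x : S → ℝ) : ℝ :=
  M.meanReward a - M.P a ⬝ᵥ x

theorem utility_eq_sum (M : ContractualBandit A S) (a : A) (x : S → ℝ) :
    M.utility a x = ∑ s, M.P a s * (M.reward s - x s) := by
  simp [utility, meanReward, dotProduct, mul_sub]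

-- The empirical utility is affine in the contract through `|S|` deviations. Control of these covers
-- all contracts at once, including ones never posted.
open Classical in
theorem Plays.sum_observed {alg : LearningAlgorithm A S} (hp : M.Plays β alg h) (a : A)
    (x : S → ℝ) :
    (h.map fun ρ => if ρ.action = a then ρ.reward - x ρ.outcome else 0).sum =
      actionCount a h * M.utility a x +
        ∑ s, outcomeDeviation M.P a s h * (M.reward s - x s) := by
  induction hp with
  | nil => simp [actionCount, outcomeDeviation]
  | @snoc h s _ ih =>
    rw [List.map_append, List.sum_append, ih, actionCount_append]
    simp only [outcomeDeviation_append, List.map_cons, List.map_nil, List.sum_cons, List.sum_nil,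
      add_zero, add_mul, Finset.sum_add_distrib]
    split_ifs with ha
    · have : ∑ s', ((if s = s' then (1 : ℝ) else 0) - M.P a s') * (M.reward s' - x s') =
          M.reward s - x s - M.utility a x := by
        rw [utility_eq_sum]
        simp [sub_mul, Finset.sum_sub_distrib]
      rw [this]
      push_cast
      ring
    · simp

/-- Within the confidence radius, the empirical utility is accurate up to the bonus. -/
theorem abs_empirical_sub_utility_le {B η : ℝ} (hη : 0 ≤ η) (hB : ∀ s, |M.reward s| ≤ B) {a : A} {x : S → ℝ}
    (hx : x ∈ contractSpace S η)
    (hdev : ∀ s, |outcomeDeviation M.P a s h| ≤ radius h.length * √(actionCount a h + 1)) :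
    |(actionCount a h * M.utility a x + ∑ s, outcomeDeviation M.P a s h * (M.reward s - x s)) /
      (actionCount a h + 1) - M.utility a x| ≤
      Fintype.card S * (|B| + η) * (radius h.length + 1) / √(actionCount a h + 1) := by
  set n := actionCount a h
  set θ := radius h.length
  have hθ : 0 ≤ θ := radius_nonneg _
  have hq : 0 < √((n : ℝ) + 1) := by positivity
  have hq1 : 1 ≤ √((n : ℝ) + 1) := Real.one_le_sqrt.2 (by simp)
  have hq2 : √((n : ℝ) + 1) * √((n : ℝ) + 1) = n + 1 := Real.mul_self_sqrt (by positivity)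
  have hf : ∀ s, |M.reward s - x s| ≤ |B| + η := fun s => by
    have h1 := (hx s).1
    have h2 := (hx s).2
    have h3 := hB s
    have h4 := le_abs_self B
    rw [abs_le] at h3 ⊢
    constructor <;> linarith
  have hX : |∑ s, outcomeDeviation M.P a s h * (M.reward s - x s)| ≤
      Fintype.card S * (|B| + η) * (θ * √((n : ℝ) + 1)) := by
    refine (Finset.abs_sum_le_sum_abs _ _).trans ?_
    calc _ ≤ ∑ _s : S, (θ * √((n : ℝ) + 1)) * (|B| + η) := Finset.sum_le_sum fun s _ => by
          rw [abs_mul]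
          exact mul_le_mul (hdev s) (hf s) (abs_nonneg _) (by positivity)
      _ = _ := by rw [Finset.sum_const, Finset.card_univ, nsmul_eq_mul]; ring
  have hu : |M.utility a x| ≤ Fintype.card S * (|B| + η) := by
    rw [utility_eq_sum]
    refine (Finset.abs_sum_le_sum_abs _ _).trans ?_
    calc _ ≤ ∑ _s : S, (|B| + η) := Finset.sum_le_sum fun s _ => by
          rw [abs_mul, abs_of_nonneg ((M.P_mem a).1 s)]
          have := hf s
          have h1 := le_one_of_mem_stdSimplex (M.P_mem a) s
          have h0 := (M.P_mem a).1 s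
          nlinarith [abs_nonneg (M.reward s - x s)]
      _ = _ := by rw [Finset.sum_const, Finset.card_univ, nsmul_eq_mul]
  set Y := ∑ s, outcomeDeviation M.P a s h * (M.reward s - x s)
  -- Dividing by `n + 1` instead of `n` leaves a bias `utility / (n + 1)`; the `+ 1` next to the
  -- radius absorbs it.
  have heq : (n * M.utility a x + Y) / ((n : ℝ) + 1) - M.utility a x =
      (Y - M.utility a x) / (n + 1) := by field_simp; ring
  have hK : 0 ≤ Fintype.card S * (|B| + η) := by positivity
  rw [heq, abs_div, abs_of_pos (by positivity : (0 : ℝ) < n + 1),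
    div_le_div_iff₀ (by positivity) hq]
  have h1 : |Y - M.utility a x| ≤ Fintype.card S * (|B| + η) * (θ + 1) * √((n : ℝ) + 1) := by
    refine (abs_sub _ _).trans ((add_le_add hX hu).trans ?_)
    nlinarith
  calc _ ≤ _ := mul_le_mul_of_nonneg_right h1 hq.le
    _ = _ := by rw [mul_assoc, hq2]

theorem utility_mem {η : ℝ} (a : A) {x : S → ℝ} (hx : x ∈ contractSpace S η) :
    M.utility a x ∈ Set.Icc (-η) 1 := by
  have h1 := dotProduct_mem_Icc_of_mem_contractSpace (M.P_mem a) hx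
  have h2 := M.meanReward_mem a
  unfold utility meanReward
  exact ⟨by linarith [h1.2, h2.1], by linarith [h1.1, h2.2]⟩

theorem sub_leastPayment_le {η b : ℝ} {a : A} (hne : (M.inducingContracts η a).Nonempty)
    (hb : ∀ x ∈ M.inducingContracts η a, M.utility a x ≤ b) :
    M.meanReward a - M.leastPayment η a ≤ b := by
  have : M.meanReward a - b ≤ M.leastPayment η a := by
    refine le_csInf (hne.image _) ?_
    rintro _ ⟨x, hx, rfl⟩
    have := hb x hx
    unfold utility at this
    simp only
    linarith
  linarith

end ContractualBandit

/-! ### Supersolutions and expectations -/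

namespace ContractualBandit

open LearnerParams

variable {A S : Type*} [Fintype S] {M : ContractualBandit A S} {β : (S → ℝ) → A}

/-- Makes the bonuses telescope in the potential `2 * √(count)`. -/
theorem one_div_sqrt_succ_le (n : ℕ) :
    1 / √((n : ℝ) + 1) ≤ 2 * √((n : ℝ) + 1) - 2 * √n := by
  have h1 : √((n : ℝ) + 1) * √((n : ℝ) + 1) = n + 1 := Real.mul_self_sqrt (by positivity)
  have h2 : √(n : ℝ) * √n = n := Real.mul_self_sqrt (by positivity)
  rw [div_le_iff₀ (by positivity)]
  nlinarith [sq_nonneg (√((n : ℝ) + 1) - √n)]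

/-- Functions of the history whose conditional expectation after a round is at most their value. -/
def IsSupersolution (M : ContractualBandit A S) (β : (S → ℝ) → A) (alg : LearningAlgorithm A S)
    (F : List (Round A S) → ℝ) : Prop :=
  ∀ h, ∑ s, M.P (β (alg h)) s * F (h ++ [⟨alg h, β (alg h), s, M.reward s⟩]) ≤ F h

namespace IsSupersolution

variable {alg : LearningAlgorithm A S} {F G : List (Round A S) → ℝ}

theorem const (c : ℝ) : M.IsSupersolution β alg fun _ => c := fun h => by
  rw [← Finset.sum_mul, (M.P_mem _).2, one_mul]

theorem add (hF : M.IsSupersolution β alg F) (hG : M.IsSupersolution β alg G) :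
    M.IsSupersolution β alg fun h => F h + G h := fun h => by
  simp only [mul_add, Finset.sum_add_distrib]
  exact add_le_add (hF h) (hG h)

theorem const_mul {c : ℝ} (hc : 0 ≤ c) (hF : M.IsSupersolution β alg F) :
    M.IsSupersolution β alg fun h => c * F h := fun h => by
  simp only [mul_left_comm _ c, ← Finset.mul_sum]
  exact mul_le_mul_of_nonneg_left (hF h) hc

theorem sum {ι : Type*} {s : Finset ι} {F : ι → List (Round A S) → ℝ}
    (hF : ∀ i ∈ s, M.IsSupersolution β alg (F i)) :
    M.IsSupersolution β alg fun h => ∑ i ∈ s, F i h := fun h => by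
  simp only [Finset.mul_sum]
  rw [Finset.sum_comm]
  exact Finset.sum_le_sum fun i hi => hF i hi h

/-- Lets the penalty of round `i` be evaluated on the first `i` rounds and stay frozen afterwards.
-/
theorem comp_take (hF : M.IsSupersolution β alg F) (i : ℕ) :
    M.IsSupersolution β alg fun h => F (h.take i) := fun h => by
  rcases lt_or_ge h.length i with hi | hi
  · have : ∀ ρ : Round A S, (h ++ [ρ]).take i = h ++ [ρ] := fun ρ =>
      List.take_of_length_le (by simpa using hi)
    simp only [this, List.take_of_length_le hi.le]
    exact hF h
  · simp only [List.take_append_of_le_length hi]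
    exact const (F (h.take i)) h

/-- A supersolution that dominates `f` on the histories of play bounds its expectation. -/
theorem expectAfter_le (hF : M.IsSupersolution β alg F) {f : List (Round A S) → ℝ} (n : ℕ) :
    ∀ h, M.Plays β alg h → (∀ g, M.Plays β alg g → g.length = h.length + n → f g ≤ F g) →
      M.expectAfter β alg f n h ≤ F h := by
  induction n with
  | zero => exact fun h hp hf => hf h hp rfl
  | succ n ih =>
    intro h hp hf
    refine (Finset.sum_le_sum fun s _ => mul_le_mul_of_nonneg_left (ih _ (hp.snoc s) ?_)
      ((M.P_mem _).1 s)).trans (hF h)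
    intro g hg hlen
    refine hf g hg ?_
    rw [hlen, List.length_append, List.length_singleton]
    omega

end IsSupersolution

theorem isSupersolution_penalty [Fintype A] (alg : LearningAlgorithm A S) (t : ℕ) :
    M.IsSupersolution β alg (penalty M.P t) := by
  unfold penalty
  refine .sum fun a _ => .sum fun s _ => .sum fun m _ => .const_mul (by positivity) (.add ?_ ?_)
  · exact fun h => sum_mul_expDeviation_append_le M.P_mem a s (abs_tilt_le t m) h _ _ _
  · exact fun h => sum_mul_expDeviation_append_le M.P_mem a s
      (by rw [abs_neg]; exact abs_tilt_le t m) h _ _ _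

/-- The `t + 1` exponents are beaten by the weight `(t + 2) ^ (-4)`. The crude bound by `gap`
suffices, as the gaps sum to order `√T`. -/
theorem penalty_nil_le [Fintype A] (P : A → S → ℝ) (t : ℕ) :
    penalty P t [] ≤ 2 * Fintype.card A * Fintype.card S * gap t := by
  have h1 : penalty P t [] =
      2 * Fintype.card A * Fintype.card S * ((t + 1) * (1 / ((t : ℝ) + 2) ^ 4)) := by
    simp only [penalty, expDeviation, outcomeDeviation, actionCount, List.map_nil, List.sum_nil,
      Finset.sum_const, Finset.card_univ, Finset.card_range, nsmul_eq_mul, mul_zero, Nat.cast_zero,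
      sub_self, Real.exp_zero]
    push_cast
    ring
  rw [h1]
  refine mul_le_mul_of_nonneg_left ?_ (by positivity)
  unfold gap
  have ht : (0 : ℝ) ≤ t := Nat.cast_nonneg t
  rw [mul_one_div, div_le_div_iff₀ (by positivity) (by positivity)]
  have h2 : √((t : ℝ) + 1) ≤ t + 2 := by
    rw [Real.sqrt_le_left (by positivity)]; nlinarith
  have h3 : ((t : ℝ) + 1) * √(t + 1) ≤ (t + 2) * (t + 2) :=
    mul_le_mul (by linarith) h2 (by positivity) (by positivity)
  have h4 : (1 : ℝ) ≤ (t + 2) ^ 2 := by nlinarith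
  nlinarith

theorem sum_gap_le (T : ℕ) : ∑ i ∈ Finset.range T, gap i ≤ 2 * √T := by
  induction T with
  | zero => simp
  | succ T ih =>
    rw [Finset.sum_range_succ]
    have : gap T ≤ 2 * √((T : ℝ) + 1) - 2 * √T := one_div_sqrt_succ_le T
    push_cast
    linarith

end ContractualBandit

/-! ### Regret along a history -/

namespace LearnerParams

open ContractualBandit

variable {A S : Type*} [Fintype S]

/-- The problem `M` and the best response `β` fit the parameters of the learner. -/
structure Fits (p : LearnerParams A) (B : ℝ) (M : ContractualBandit A S) (β : (S → ℝ) → A) :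
    Prop where
  eta_pos : 0 < p.eta
  kappa_pos : 0 < p.kappa
  margin : ∀ a a', p.cost a - p.cost a' + p.kappa * 2 ^ Fintype.card S ≤ p.lam * p.eta
  bonus_eq : p.bonus = Fintype.card S * (|B| + p.eta)
  cost_eq : M.cost = p.cost
  inducible : M.Inducible p.lam
  bestResponse : M.IsBestResponse p.eta β
  reward_le : ∀ s, |M.reward s| ≤ B

variable {p : LearnerParams A} {B : ℝ} {M : ContractualBandit A S} {β : (S → ℝ) → A}

theorem Fits.inducingContracts_nonempty (hf : p.Fits B M β) (a : A) :
    (M.inducingContracts p.eta a).Nonempty :=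
  ContractualBandit.inducingContracts_nonempty hf.eta_pos (fun a a' => by
    have h1 := hf.margin a a'
    have h2 := hf.kappa_pos
    have : 0 ≤ p.kappa * 2 ^ Fintype.card S := by positivity
    linarith) hf.cost_eq hf.inducible a

theorem Fits.sub_leastPayment_le_one (hf : p.Fits B M β) (a : A) :
    M.meanReward a - M.leastPayment p.eta a ≤ 1 :=
  sub_leastPayment_le (hf.inducingContracts_nonempty a) fun _ hx => (utility_mem a hx.1).2

variable [Nonempty A] {h : List (Round A S)}

theorem Fits.admissiblePlans_nonempty (hf : p.Fits B M β) (hp : M.Plays β p.learner h)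
    (hlen : (probes S p.eta).length ≤ h.length) {a : A} {x : S → ℝ}
    (hx : x ∈ M.inducingContracts p.eta a) :
    ∃ π ∈ p.admissiblePlans h, π.target = a ∧ π.goal = x :=
  hp.admissiblePlans_nonempty hf.eta_pos (δ := p.kappa * 2 ^ Fintype.card S)
    (by have := hf.kappa_pos; positivity) hf.margin le_rfl hf.cost_eq hf.inducible
    hf.bestResponse hlen hx

theorem Fits.abs_index_sub_utility_le (hf : p.Fits B M β) (hp : M.Plays β p.learner h)
    {π : ContractPlan A S} (hπ : π.goal ∈ contractSpace S p.eta)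
    (hdev : ∀ s, |outcomeDeviation M.P π.target s h| ≤
      radius h.length * √(actionCount π.target h + 1)) :
    M.utility π.target π.goal ≤ p.index h π ∧ p.index h π ≤ M.utility π.target π.goal +
      2 * (p.bonus * (radius h.length + 1) / √(actionCount π.target h + 1)) := by
  have h1 := abs_empirical_sub_utility_le hf.eta_pos.le hf.reward_le hπ hdev
  rw [← hf.bonus_eq, abs_le] at h1
  unfold index
  rw [hp.sum_observed]
  constructor <;> linarith [h1.1, h1.2]

variable [Fintype A]

theorem Fits.isNearOptimal_plan (hf : p.Fits B M β) (hp : M.Plays β p.learner h)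
    (hlen : (probes S p.eta).length ≤ h.length) : p.IsNearOptimal h (p.plan h) := by
  obtain ⟨x, hx⟩ := hf.inducingContracts_nonempty (Classical.arbitrary A)
  obtain ⟨π, hπ, -⟩ := hf.admissiblePlans_nonempty hp hlen hx
  exact p.isNearOptimal_plan ⟨π, hπ⟩

/-- Utility lost in a round that answers the contract of a plan by its target, while all
deviations are within the confidence radius. -/
theorem Fits.regret_of_answered_plan (hf : p.Fits B M β) (hp : M.Plays β p.learner h)
    (hlen : (probes S p.eta).length ≤ h.length)
    (hdev : ∀ a s, |outcomeDeviation M.P a s h| ≤ radius h.length * √(actionCount a h + 1))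
    (a : A) :
    M.meanReward a - M.leastPayment p.eta a -
        M.utility (p.plan h).target ((p.plan h).point (1 - gap h.length)) ≤
      (1 + p.eta) * gap h.length +
        2 * (p.bonus * (radius h.length + 1) / √(actionCount (p.plan h).target h + 1)) := by
  have hplan := hf.isNearOptimal_plan hp hlen
  set π := p.plan h
  have hupper := (hf.abs_index_sub_utility_le hp hplan.1.2.2.1 (hdev π.target)).2
  -- Every truly inducing contract is the goal of an admissible plan, whose index is at least its
  -- utility and at most that of the chosen plan up to `gap`.
  have hbest : M.meanReward a - M.leastPayment p.eta a ≤ p.index h π + gap h.length := by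
    refine sub_leastPayment_le (hf.inducingContracts_nonempty a) fun x hx => ?_
    obtain ⟨π', hπ', rfl, rfl⟩ := hf.admissiblePlans_nonempty hp hlen hx
    exact (hf.abs_index_sub_utility_le hp hπ'.2.2.1 (hdev π'.target)).1.trans (hplan.2 π' hπ')
  have hmix : M.utility π.target π.goal - p.eta * gap h.length ≤
      M.utility π.target (π.point (1 - gap h.length)) := by
    unfold utility
    rw [ContractPlan.dotProduct_point]
    have h1 := dotProduct_mem_Icc_of_mem_contractSpace (M.P_mem π.target) hplan.1.1.1
    have h2 := dotProduct_mem_Icc_of_mem_contractSpace (M.P_mem π.target) hplan.1.2.2.1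
    have hg := gap_pos h.length
    nlinarith [h1.2, h2.1]
  linarith

open Classical in
/-- The regret of a single round. -/
theorem Fits.round_regret_le (hf : p.Fits B M β) (hp : M.Plays β p.learner h) (a : A)
    (ρ : Round A S) (hx : ρ.contract = p.learner h) :
    M.meanReward a - M.leastPayment p.eta a - M.utility ρ.action ρ.contract ≤
      (1 + p.eta) * ((if h.length < (probes S p.eta).length then 1 else 0) +
        (if (p.phase h.reverse).isSome ∨
          ((probes S p.eta).length ≤ h.length ∧ ρ.action ≠ (p.plan h).target)
        then 1 else 0) + (penalty M.P h.length h + gap h.length)) +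
      2 * (p.bonus * (radius h.length + 1) / √(actionCount ρ.action h + 1)) := by
  have hη := hf.eta_pos
  have hpen := penalty_nonneg M.P h.length h
  have hgap := (gap_pos h.length).le
  have hθ := radius_nonneg h.length
  have hbonus : 0 ≤ p.bonus := by rw [hf.bonus_eq]; positivity
  have hlast : 0 ≤ 2 * (p.bonus * (radius h.length + 1) / √(actionCount ρ.action h + 1)) := by
    positivity
  have htriv : M.meanReward a - M.leastPayment p.eta a - M.utility ρ.action ρ.contract ≤
      1 + p.eta := by
    have h1 := (utility_mem (M := M) ρ.action (hx ▸ p.learner_mem hη.le h)).1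
    linarith [hf.sub_leastPayment_le_one a]
  have hbig : ∀ u : ℝ, 1 ≤ u → M.meanReward a - M.leastPayment p.eta a -
      M.utility ρ.action ρ.contract ≤ (1 + p.eta) * u +
        2 * (p.bonus * (radius h.length + 1) / √(actionCount ρ.action h + 1)) := by
    intro u hu
    nlinarith
  by_cases h1 : h.length < (probes S p.eta).length
  · refine hbig _ ?_
    rw [if_pos h1]
    split_ifs <;> linarith
  by_cases h2 : (p.phase h.reverse).isSome ∨
      ((probes S p.eta).length ≤ h.length ∧ ρ.action ≠ (p.plan h).target)
  · refine hbig _ ?_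
    rw [if_pos h2, if_neg h1]
    linarith
  -- The penalty plays the role of the failure event: if it is at least `1` it pays for the round,
  -- otherwise all deviations are within the radius.
  by_cases h3 : 1 ≤ penalty M.P h.length h
  · refine hbig _ ?_
    rw [if_neg h2, if_neg h1]
    linarith
  rw [if_neg h1, if_neg h2]
  push Not at h1 h2
  have hdev : ∀ a s, |outcomeDeviation M.P a s h| ≤ radius h.length * √(actionCount a h + 1) := by
    intro a s
    by_contra! hcon
    exact h3 (one_le_penalty M.P_mem hcon)
  have hphase : p.phase h.reverse = none := by simpa using h2.1
  have hpost := learner_eq_of_phase_none (hf.isNearOptimal_plan hp h1) h1 hphase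
  have hact := h2.2 h1
  have := hf.regret_of_answered_plan hp h1 hdev a
  rw [hact, hx, hpost]
  nlinarith

/-- Regret along a history, in terms of initial rounds, lost rounds, penalties and counts. -/
theorem Fits.sum_regret_le (hf : p.Fits B M β) (hp : M.Plays β p.learner h) (a : A) :
    (h.map fun _ => M.meanReward a - M.leastPayment p.eta a).sum -
        (h.map fun ρ => M.meanReward ρ.action - M.P ρ.action ⬝ᵥ ρ.contract).sum ≤
      (1 + p.eta) * ((min h.length (probes S p.eta).length : ℕ) + (lostRounds p h.reverse : ℝ) +
        ∑ i ∈ Finset.range h.length, (penalty M.P i (h.take i) + gap i)) +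
      2 * (p.bonus * (radius h.length + 1) * ∑ b, 2 * √(actionCount b h)) := by
  classical
  have hbonus : 0 ≤ p.bonus := by have := hf.eta_pos; rw [hf.bonus_eq]; positivity
  induction hp with
  | nil => simp [lostRounds, actionCount]
  | @snoc h s hp ih =>
    set ρ : Round A S := ⟨p.learner h, β (p.learner h), s, M.reward s⟩ with hρ
    have hround := hf.round_regret_le hp a ρ rfl
    have hrev : (h ++ [ρ]).reverse = ρ :: h.reverse := by simp
    have hlen : (h ++ [ρ]).length = h.length + 1 := by simp
    have hmin : ((min (h.length + 1) (probes S p.eta).length : ℕ) : ℝ) =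
        (min h.length (probes S p.eta).length : ℕ) +
          if h.length < (probes S p.eta).length then 1 else 0 := by
      split_ifs with hc
      · rw [min_eq_left (by omega), min_eq_left (by omega)]; push_cast; rfl
      · rw [min_eq_right (by omega), min_eq_right (by omega)]; simp
    have hsum : ∑ i ∈ Finset.range (h.length + 1), (penalty M.P i ((h ++ [ρ]).take i) + gap i) =
        ∑ i ∈ Finset.range h.length, (penalty M.P i (h.take i) + gap i) +
          (penalty M.P h.length h + gap h.length) := by
      rw [Finset.sum_range_succ]
      congr 1
      · refine Finset.sum_congr rfl fun i hi => ?_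
        rw [List.take_append_of_le_length (Finset.mem_range.1 hi).le]
      · simp
    have hcount : ∑ b, 2 * √(actionCount b (h ++ [ρ])) = ∑ b, 2 * √(actionCount b h) +
        (2 * √((actionCount ρ.action h : ℝ) + 1) - 2 * √(actionCount ρ.action h)) := by
      rw [← Finset.add_sum_erase _ _ (Finset.mem_univ ρ.action),
        ← Finset.add_sum_erase _ _ (Finset.mem_univ ρ.action), actionCount_append, if_pos rfl]
      have : ∑ b ∈ Finset.univ.erase ρ.action, 2 * √(actionCount b (h ++ [ρ])) =
          ∑ b ∈ Finset.univ.erase ρ.action, 2 * √(actionCount b h) := by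
        refine Finset.sum_congr rfl fun b hb => ?_
        rw [actionCount_append, if_neg (Finset.ne_of_mem_erase hb).symm, add_zero]
      rw [this]
      push_cast
      ring
    have hθ0 := radius_nonneg h.length
    have hθ : radius h.length ≤ radius (h.length + 1) := radius_mono (Nat.le_succ _)
    have hnew : p.bonus * (radius h.length + 1) / √(actionCount ρ.action h + 1) ≤
        p.bonus * (radius h.length + 1) *
          (2 * √((actionCount ρ.action h : ℝ) + 1) - 2 * √(actionCount ρ.action h)) := by
      rw [div_eq_mul_one_div]
      exact mul_le_mul_of_nonneg_left (one_div_sqrt_succ_le _) (by positivity)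
    have hgrow : p.bonus * (radius h.length + 1) * ∑ b, 2 * √(actionCount b (h ++ [ρ])) ≤
        p.bonus * (radius (h.length + 1) + 1) * ∑ b, 2 * √(actionCount b (h ++ [ρ])) := by
      gcongr
    rw [hlen, hrev, hmin, hsum]
    simp only [lostRounds, List.map_append, List.sum_append, List.map_cons, List.map_nil,
      List.sum_cons, List.sum_nil, add_zero, List.length_reverse, List.reverse_reverse]
    rw [hcount] at hgrow ⊢
    unfold utility at hround
    push_cast at ih ⊢
    linarith

end LearnerParams

/-! ### Polylogarithmic search cost and the final bound -/

namespace LearnerParams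

open ContractualBandit

variable {A S : Type*} [Fintype S] [Fintype A] [Nonempty A]
  {p : LearnerParams A} {B : ℝ} {M : ContractualBandit A S} {β : (S → ℝ) → A}
  {h : List (Round A S)}

/-- The number of rounds spent on searches is polylogarithmic. -/
theorem Fits.lostRounds_le (hf : p.Fits B M β) (hp : M.Plays β p.learner h) {m : ℕ}
    (hdepth : ∀ k, p.depth k = (k + 1) * (Fintype.card (A × S) + 1) + m)
    (hm : ((Fintype.card (A × S) + 1).factorial : ℝ) * (2 * p.eta) ^ (Fintype.card (A × S) + 1) <
      p.kappa ^ (Fintype.card (A × S) + 1) * 2 ^ m) :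
    lostRounds p h.reverse ≤ (Nat.log 2 (h.length + 1) + 1) ^ 2 *
      ((Fintype.card (A × S) + 1) * (Fintype.card (A × S) + m + 3)) := by
  have hmono : Monotone p.depth := by
    intro k k' hk
    rw [hdepth, hdepth]
    gcongr
  have hη := hf.eta_pos
  have hκ := hf.kappa_pos
  obtain ⟨L, j, hL, hlost, hnone, hsome⟩ := hp.exists_records hη hκ hmono hf.cost_eq hf.inducible
    hf.bestResponse fun g hg hlen => hf.isNearOptimal_plan hg hlen
  set D := Fintype.card (A × S)
  set K := Nat.log 2 (h.length + 1)
  have hlen : L.length ≤ (K + 1) * D := by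
    refine hL.length_le M.P_mem hη hκ fun k => ?_
    change ((D + 1).factorial : ℝ) * (p.tolerance k * (2 * p.eta) ^ D) <
      (p.kappa / 2 ^ (k + 1)) ^ (D + 1)
    have h2 : (0 : ℝ) < 2 ^ m := by positivity
    -- The part `(k + 1) * (D + 1)` of the depth cancels the powers of `2 ^ (k + 1)` in the margin,
    -- leaving the level-free condition on `m`.
    rw [tolerance, hdepth, div_pow, ← pow_mul, lt_div_iff₀ (by positivity), pow_add]
    calc _ = ((D + 1).factorial : ℝ) * (2 * p.eta) ^ (D + 1) / 2 ^ m := by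
          rw [pow_succ (2 * p.eta)]
          field_simp
      _ < p.kappa ^ (D + 1) := by rwa [div_lt_iff₀ h2]
  have hj : j ≤ p.depth K + 1 := by
    rcases hph : p.phase h.reverse with _ | σ
    · rw [hnone hph]; exact Nat.zero_le _
    · have h1 := (hsome σ hph).count
      have h2 : p.depth σ.level ≤ p.depth K := hmono (hsome σ hph).level_le
      omega
  have hd : p.depth K + 2 ≤ (K + 1) * (D + m + 3) := by
    rw [hdepth]
    nlinarith
  calc lostRounds p h.reverse ≤ L.length * (p.depth K + 2) + j := hlost
    _ ≤ (K + 1) * D * (p.depth K + 2) + (K + 1) * (p.depth K + 2) := by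
        gcongr
        nlinarith
    _ = (K + 1) * (D + 1) * (p.depth K + 2) := by ring
    _ ≤ (K + 1) * (D + 1) * ((K + 1) * (D + m + 3)) := by gcongr
    _ = _ := by ring

theorem log_bounds {T : ℕ} (hT : 2 ≤ T) : 1 ≤ 2 * Real.log T ∧
    ((Nat.log 2 (T + 1) : ℝ) + 1) ≤ 6 * Real.log T ∧ radius T + 1 ≤ 18 * Real.log T := by
  have hT' : (2 : ℝ) ≤ T := by exact_mod_cast hT
  have hl2 := Real.log_two_gt_d9
  have h2 : Real.log 2 ≤ Real.log T := Real.log_le_log (by norm_num) hT'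
  have hsq : Real.log (T + 2) ≤ 2 * Real.log T := by
    rw [← Real.log_rpow (by linarith)]
    refine Real.log_le_log (by linarith) ?_
    norm_num
    nlinarith
  refine ⟨by linarith, ?_, ?_⟩
  · have h3 : (Nat.log 2 (T + 1) : ℝ) * Real.log 2 ≤ Real.log (T + 2) := by
      rw [← Real.log_pow]
      refine Real.log_le_log (by positivity) ?_
      have : 2 ^ Nat.log 2 (T + 1) ≤ T + 1 := Nat.pow_log_le_self 2 (by omega)
      have h4 : (2 : ℝ) ^ Nat.log 2 (T + 1) ≤ T + 1 := by exact_mod_cast this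
      linarith
    have h5 : (0 : ℝ) ≤ Nat.log 2 (T + 1) := Nat.cast_nonneg _
    nlinarith
  · unfold radius
    have h6 : √(Real.log (T + 2)) ≤ Real.log (T + 2) + 1 := by
      rw [Real.sqrt_le_left (by linarith [Real.log_nonneg (by linarith : (1:ℝ) ≤ T + 2)])]
      nlinarith [Real.log_nonneg (by linarith : (1:ℝ) ≤ T + 2)]
    linarith

/-- The constant of the regret bound. -/
noncomputable def regretConstant (S : Type*) [Fintype S] (p : LearnerParams A) (m : ℕ) : ℝ :=
  (1 + p.eta) * (4 * (probes S p.eta).length +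
    36 * ((Fintype.card (A × S) + 1) * (Fintype.card (A × S) + m + 3)) +
    8 * (2 * Fintype.card A * Fintype.card S + 1)) + 144 * (p.bonus * Fintype.card A)

/-- The expected regret of the learner. -/
theorem Fits.expectedRegret_le (hf : p.Fits B M β) {m : ℕ}
    (hdepth : ∀ k, p.depth k = (k + 1) * (Fintype.card (A × S) + 1) + m)
    (hm : ((Fintype.card (A × S) + 1).factorial : ℝ) * (2 * p.eta) ^ (Fintype.card (A × S) + 1) <
      p.kappa ^ (Fintype.card (A × S) + 1) * 2 ^ m) {T : ℕ} (hT : 2 ≤ T) :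
    M.expectedRegret p.eta β p.learner T ≤
      regretConstant S p m * √T * Real.log T ^ 2 := by
  have hη := hf.eta_pos
  have hbonus : 0 ≤ p.bonus := by rw [hf.bonus_eq]; positivity
  set N : ℝ := ((probes S p.eta).length : ℝ) with hN_def
  set E : ℝ := ((Fintype.card (A × S) : ℝ) + 1) * (Fintype.card (A × S) + m + 3)
  set K : ℕ := Nat.log 2 (T + 1)
  set c : ℝ := (1 + p.eta) * (N + ((K : ℝ) + 1) ^ 2 * E) +
    2 * (p.bonus * (radius T + 1) * (2 * Fintype.card A * √T))
  -- Only the penalties are random in the pathwise bound, so its expectation is at most its value at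
  -- the empty history.
  have hsuper : M.IsSupersolution β p.learner fun h => c + (1 + p.eta) *
      ∑ i ∈ Finset.range T, (penalty M.P i (h.take i) + gap i) :=
    (IsSupersolution.const c).add <| .const_mul (by linarith) <| .sum fun i _ =>
      ((isSupersolution_penalty p.learner i).comp_take i).add (.const _)
  have hexp := hsuper.expectAfter_le (f := M.regret p.eta) T [] .nil (by
    intro g hg hlen
    rw [List.length_nil, zero_add] at hlen
    have hlost := hf.lostRounds_le hg hdepth hm
    rw [hlen] at hlost
    have hlost' : (lostRounds p g.reverse : ℝ) ≤ ((K : ℝ) + 1) ^ 2 * E := by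
      have := (Nat.cast_le (α := ℝ)).2 hlost
      push_cast at this
      exact this
    have hcount : ∑ b : A, 2 * √(actionCount b g : ℝ) ≤ 2 * Fintype.card A * √T := by
      calc ∑ b : A, 2 * √(actionCount b g : ℝ) ≤ ∑ _b : A, 2 * √(T : ℝ) := by
            gcongr with b
            exact hlen ▸ actionCount_le_length b g
        _ = _ := by rw [Finset.sum_const, Finset.card_univ, nsmul_eq_mul]; ring
    have hmin : ((min g.length (probes S p.eta).length : ℕ) : ℝ) ≤ N :=
      Nat.cast_le.2 (min_le_right _ _)
    have hθ := radius_nonneg T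
    unfold regret
    rw [sub_le_iff_le_add]
    refine ciSup_le fun a => ?_
    rw [← sub_le_iff_le_add]
    refine (hf.sum_regret_le hg a).trans ?_
    rw [hlen]
    have h1 : p.bonus * (radius T + 1) * ∑ b : A, 2 * √(actionCount b g : ℝ) ≤
        p.bonus * (radius T + 1) * (2 * Fintype.card A * √T) := by gcongr
    have h2 : (1 + p.eta) * (((min g.length (probes S p.eta).length : ℕ) : ℝ) +
        (lostRounds p g.reverse : ℝ)) ≤ (1 + p.eta) * (N + ((K : ℝ) + 1) ^ 2 * E) :=
      mul_le_mul_of_nonneg_left (add_le_add hmin hlost') (by linarith)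
    rw [hlen] at h2
    simp only [c]
    linarith)
  refine hexp.trans ?_
  obtain ⟨hl1, hl2, hl3⟩ := log_bounds hT
  set l := Real.log T
  have hs1 : 1 ≤ √(T : ℝ) := Real.one_le_sqrt.2 (by exact_mod_cast (by omega : 1 ≤ T))
  have hsum : ∑ i ∈ Finset.range T, (penalty M.P i (([] : List (Round A S)).take i) + gap i) ≤
      (2 * Fintype.card A * Fintype.card S + 1) * (2 * √T) := by
    calc _ ≤ ∑ i ∈ Finset.range T, (2 * Fintype.card A * Fintype.card S + 1) * gap i :=
          Finset.sum_le_sum fun i _ => by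
            rw [List.take_nil]
            linarith [penalty_nil_le M.P i]
      _ ≤ _ := by
          rw [← Finset.mul_sum]
          exact mul_le_mul_of_nonneg_left (sum_gap_le T) (by positivity)
  have hl0 : 0 ≤ l := by linarith
  have hll : 1 ≤ 4 * l ^ 2 := by nlinarith
  have hN : N ≤ 4 * N * (√T * l ^ 2) := by
    have : 1 ≤ 4 * (√T * l ^ 2) := by nlinarith
    have hN0 : 0 ≤ N := Nat.cast_nonneg _
    nlinarith
  have hE : ((K : ℝ) + 1) ^ 2 * E ≤ 36 * E * (√T * l ^ 2) := by
    have hE0 : 0 ≤ E := by positivity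
    have h1 : ((K : ℝ) + 1) ^ 2 ≤ (6 * l) ^ 2 := by gcongr
    have h2 : l ^ 2 ≤ √T * l ^ 2 := le_mul_of_one_le_left (by positivity) hs1
    have h3 : ((K : ℝ) + 1) ^ 2 ≤ 36 * (√T * l ^ 2) := by linarith
    calc _ ≤ 36 * (√T * l ^ 2) * E := mul_le_mul_of_nonneg_right h3 hE0
      _ = _ := by ring
  have hS : (2 * Fintype.card A * Fintype.card S + 1 : ℝ) * (2 * √T) ≤
      8 * (2 * Fintype.card A * Fintype.card S + 1) * (√T * l ^ 2) := by
    have h1 : 2 * √(T : ℝ) ≤ 8 * (√T * l ^ 2) := by nlinarith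
    calc _ ≤ (2 * Fintype.card A * Fintype.card S + 1 : ℝ) * (8 * (√T * l ^ 2)) :=
          mul_le_mul_of_nonneg_left h1 (by positivity)
      _ = _ := by ring
  have hR : 2 * (p.bonus * (radius T + 1) * (2 * Fintype.card A * √T)) ≤
      144 * (p.bonus * Fintype.card A) * (√T * l ^ 2) := by
    have h1 : radius T + 1 ≤ 36 * l ^ 2 := by nlinarith
    calc _ = 4 * (p.bonus * Fintype.card A * √T) * (radius T + 1) := by ring
      _ ≤ 4 * (p.bonus * Fintype.card A * √T) * (36 * l ^ 2) := by gcongr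
      _ = _ := by ring
  have hall := mul_le_mul_of_nonneg_left (add_le_add (add_le_add hN hE) (hsum.trans hS))
    (by linarith : 0 ≤ 1 + p.eta)
  simp only [c, regretConstant]
  linarith

end LearnerParams

theorem mainTheorem5 :
    ∃ k : ℕ, ∀ (A : Type*) (S : Type*) [Fintype A] [Nonempty A] [Fintype S]
      (η lam B : ℝ) (c : A → ℝ), 0 < lam → (∀ a a', c a - c a' < lam * η) →
      ∃ (C : ℝ) (alg : LearningAlgorithm A S), (∀ h, alg h ∈ contractSpace S η) ∧
        ∀ M : ContractualBandit A S, M.cost = c → M.Inducible lam → (∀ s, |M.reward s| ≤ B) →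
          ∀ β : (S → ℝ) → A, M.IsBestResponse η β →
            ∀ T : ℕ, 2 ≤ T →
              M.expectedRegret η β alg T ≤ C * Real.sqrt T * Real.log T ^ k := by
  refine ⟨2, ?_⟩
  intro A S _ _ _ η lam B c hlam hcost
  have hη : 0 < η := by
    have := hcost (Classical.arbitrary A) (Classical.arbitrary A)
    rw [sub_self] at this
    exact pos_of_mul_pos_right this hlam.le
  obtain ⟨⟨a₁, a₂⟩, hmax⟩ := Finite.exists_max fun a : A × A => c a.1 - c a.2
  -- The uniform slack of the strict cost condition, divided by the number of probes over which a
  -- base may be averaged.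
  set κ : ℝ := (lam * η - (c a₁ - c a₂)) / 2 ^ Fintype.card S with hκ_def
  have hκ : 0 < κ := div_pos (by linarith [hcost a₁ a₂]) (by positivity)
  set D := Fintype.card (A × S)
  obtain ⟨m, hm⟩ := pow_unbounded_of_one_lt
    (((D + 1).factorial : ℝ) * (2 * η) ^ (D + 1) / κ ^ (D + 1)) (one_lt_two (α := ℝ))
  rw [div_lt_iff₀ (by positivity), mul_comm (2 ^ m)] at hm
  let p : LearnerParams A := ⟨η, lam, κ, Fintype.card S * (|B| + η), c,
    fun k => (k + 1) * (D + 1) + m⟩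
  refine ⟨p.regretConstant S m, p.learner, fun h => p.learner_mem hη.le h, fun M hc hi hB β hβ T hT => ?_⟩
  have hf : p.Fits B M β :=
    { eta_pos := hη
      kappa_pos := hκ
      margin := fun a a' => by
        have h1 : κ * 2 ^ Fintype.card S = lam * η - (c a₁ - c a₂) := by
          rw [hκ_def, div_mul_cancel₀ _ (by positivity)]
        have h2 := hmax (a, a')
        simp only at h2
        simp only [p]
        linarith
      bonus_eq := rfl
      cost_eq := hc
      inducible := hi
      bestResponse := hβ
      reward_le := hB }
  exact hf.expectedRegret_le (fun _ => rfl) hm hT
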